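/- Let $f\in\mathbb{C}[x,y,z]$ be a ternary quartic form defining a smooth plane curve. Let $K\subset\mathbb{C}$ be a subfield over which all bitangents of $f$ are defined, that is, $K$ contains the ratios of the coefficients of every linear form $\ell\neq 0$ such that $f=g^2+\ell h$ for some complex quadratic form $g$ and cubic form $h$. (In the main case $f$ has rational coefficients and $K$ is generated over $\mathbb{Q}$ by these ratios.) Let $M=xA+yB+zC$ with symmetric $4\times4$ matrices $A,B,C$ over $K$ such that $\det M=\gamma f$ for some $\gamma\in\mathbb{C}\setminus\{0\}$, and let the eight points $P_1,\dots,P_8\in\mathbb{P}^3(\mathbb{C})$, in any order, be the Cayley octad of $M$, that is, the set of common zeros of the three quadrics $uAu^T,uBu^T,uCu^T$. Then the points $P_1,\dots,P_8$ are $K$-rational. For every $8\times 4$ matrix $Q$ over $K$ whose rows represent $P_1,\dots,P_8$, the following holds. (a) Let $M_{1234}$ be the upper left $4\times4$ block of $QMQ^T$, and let $S$ be the matrix formed by the first four rows of $Q$. Then $S$ is invertible, the rows of $O:=QS^{-1}$ represent the Cayley octad of $M_{1234}$, the first four rows of $O$ are the standard basis vectors, all entries of its last four rows are nonzero, and $OM_{1234}O^T=QMQ^T$.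 Write $OM_{1234}O^T=(b_{ij})_{1\le i,j\le 8}$ for the bitangent matrix of $M_{1234}$. (b) Let $$M'_{1234}=\begin{pmatrix}0&b_{34}&b_{24}&b_{23}\\ b_{34}&0&b_{14}&b_{13}\\ b_{24}&b_{14}&0&b_{12}\\ b_{23}&b_{13}&b_{12}&0\end{pmatrix}$$ be the bifid substitution of $M_{1234}$. Let $O'$ be any $8\times4$ matrix over $K$ whose $i$-th row is a nonzero $K$-multiple of the $i$-th row of $O$ for $i\le 4$, and of the vector of reciprocals of the entries of the $i$-th row of $O$ for $i\ge 5$. Then the rows of $O'$ represent the Cayley octad of $M'_{1234}$. Write $O'M'_{1234}O'^T=(b'_{ij})_{1\le i,j\le8}$ for the bitangent matrix of $M'_{1234}$. (c) For all $i,j,k,l\in\{1,\dots,8\}$ there are nonzero scalars in $K$ by which $$b'_{ij}\ \text{ is a multiple of }\ \begin{cases} b_{kl} & \text{if } \{i,j,k,l\}=\{1,2,3,4\},\\ b_{ij} & \text{if } i\neq j \text{ and } |\{i,j\}\cap\{1,2,3,4\}|=1,\\ b_{kl} & \text{if } \{i,j,k,l\}=\{5,6,7,8\}.\end{cases}$$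 -/

import Mathlib

open MvPolynomial

/-- The linear form `a₀ x + a₁ y + a₂ z`. -/
noncomputable def linearForm {F : Type*} [Field F] (a : Fin 3 → F) : MvPolynomial (Fin 3) F :=
  ∑ t, C (a t) * X t

/-- The plane curve `f = 0` over `ℂ` has no singular point in the projective plane. -/
def IsSmoothForm (f : MvPolynomial (Fin 3) ℂ) : Prop :=
  ∀ p : Fin 3 → ℂ, eval p f = 0 → (∀ t, eval p (pderiv t f) = 0) → p = 0

/-- The line `a₀ x + a₁ y + a₂ z = 0` is a bitangent of the quartic `f`:
there are a quadric `g` and a cubic `h` with `f = g² + ℓ h`. -/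
def IsBitangent (f : MvPolynomial (Fin 3) ℂ) (a : Fin 3 → ℂ) : Prop :=
  a ≠ 0 ∧ ∃ g h : MvPolynomial (Fin 3) ℂ, g.IsHomogeneous 2 ∧ h.IsHomogeneous 3 ∧
    f = g ^ 2 + linearForm a * h

/-- The smallest subfield of `ℂ` over which all bitangents `(α : β : γ)` of `f` are defined.
As the coefficients of a line are only defined up to a common factor, it is generated by their
ratios. -/
noncomputable def bitangentField (f : MvPolynomial (Fin 3) ℂ) : IntermediateField ℚ ℂ :=
  IntermediateField.adjoin ℚ
    {r : ℂ | ∃ a : Fin 3 → ℂ, IsBitangent f a ∧ ∃ s t, a t ≠ 0 ∧ r = a s / a t}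

/-- The matrix of linear forms `M = x A₀ + y A₁ + z A₂`. -/
noncomputable def linearMatrix {F : Type*} [Field F] {n : Type*} (A : Fin 3 → Matrix n n F) :
    Matrix n n (MvPolynomial (Fin 3) F) :=
  Matrix.of fun i j => linearForm fun t => A t i j

/-- The rows of `O` and of `O'` represent the same points of projective space. -/
def SamePoints {F : Type*} [Field F] (O O' : Matrix (Fin 8) (Fin 4) F) : Prop :=
  ∀ i, ∃ c : F, c ≠ 0 ∧ O i = c • O' i

/-- The rows of `O` represent eight distinct points of `ℙ³(ℂ)`, and these are exactly the common
zeros of the three quadrics `u A₀ uᵀ`, `u A₁ uᵀ`, `u A₂ uᵀ`. -/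
def IsCayleyOctad (A : Fin 3 → Matrix (Fin 4) (Fin 4) ℂ) (O : Matrix (Fin 8) (Fin 4) ℂ) : Prop :=
  (∀ i, O i ≠ 0) ∧
  (∀ i j, ∀ c : ℂ, O i = c • O j → i = j) ∧
  ∀ u : Fin 4 → ℂ, u ≠ 0 →
    ((∀ t, u ⬝ᵥ (A t).mulVec u = 0) ↔ ∃ i, ∃ c : ℂ, u = c • O i)

/-- The bitangent matrix `O M Oᵀ = (b i j)`, where `M = x A₀ + y A₁ + z A₂`. -/
noncomputable def bitangentMatrix {F : Type*} [Field F] (A : Fin 3 → Matrix (Fin 4) (Fin 4) F)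
    (O : Matrix (Fin 8) (Fin 4) F) : Matrix (Fin 8) (Fin 8) (MvPolynomial (Fin 3) F) :=
  Matrix.map O (C : F →+* MvPolynomial (Fin 3) F) * linearMatrix A *
    (Matrix.map O (C : F →+* MvPolynomial (Fin 3) F)).transpose

/-- The inclusion of the first four of the eight indices. -/
def firstFour : Fin 4 → Fin 8 := Fin.castLE (by norm_num)

/-- The coefficient matrices of `M₁₂₃₄`, the upper left `4 × 4` block of the bitangent matrix;
see `linearMatrix_principalBlock`. -/
def principalBlock {F : Type*} [Field F] (A : Fin 3 → Matrix (Fin 4) (Fin 4) F)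
    (O : Matrix (Fin 8) (Fin 4) F) : Fin 3 → Matrix (Fin 4) (Fin 4) F :=
  fun t => (O * A t * O.transpose).submatrix firstFour firstFour

theorem linearMatrix_principalBlock {F : Type*} [Field F]
    (A : Fin 3 → Matrix (Fin 4) (Fin 4) F) (O : Matrix (Fin 8) (Fin 4) F) :
    linearMatrix (principalBlock A O) = (bitangentMatrix A O).submatrix firstFour firstFour := by
  ext1 i j
  simp only [linearMatrix, principalBlock, bitangentMatrix, linearForm, Matrix.of_apply,
    Matrix.submatrix_apply, Matrix.mul_apply, Matrix.map_apply, Matrix.transpose_apply,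
    Fin.sum_univ_three, Fin.sum_univ_four, map_add, map_mul]
  ring

/-- The bifid substitution on a `4 × 4` matrix: off the diagonal the entry at `(i, j)` becomes the
entry at `(k, l)`, where `{i, j, k, l}` is the full index set. -/
def bifidMatrix {R : Type*} [Zero R] (N : Matrix (Fin 4) (Fin 4) R) : Matrix (Fin 4) (Fin 4) R :=
  !![0, N 2 3, N 1 3, N 1 2;
     N 2 3, 0, N 0 3, N 0 2;
     N 1 3, N 0 3, 0, N 0 1;
     N 1 2, N 0 2, N 0 1, 0]

/-- The coefficient matrices of `M'₁₂₃₄`. -/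
def bifidBlock {F : Type*} [Field F] (A : Fin 3 → Matrix (Fin 4) (Fin 4) F)
    (O : Matrix (Fin 8) (Fin 4) F) : Fin 3 → Matrix (Fin 4) (Fin 4) F :=
  fun t => bifidMatrix (principalBlock A O t)

theorem linearMatrix_bifidBlock {F : Type*} [Field F]
    (A : Fin 3 → Matrix (Fin 4) (Fin 4) F) (O : Matrix (Fin 8) (Fin 4) F) :
    linearMatrix (bifidBlock A O) = bifidMatrix (linearMatrix (principalBlock A O)) := by
  ext1 i j
  fin_cases i <;> fin_cases j <;> simp [linearMatrix, bifidBlock, bifidMatrix, linearForm]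

/-- The octad `O` in the coordinates in which its first four points are the standard basis
vectors: `O P⁻¹`, where `P` consists of the first four rows of `O`. -/
noncomputable def normalizedOctad {F : Type*} [Field F] (O : Matrix (Fin 8) (Fin 4) F) :
    Matrix (Fin 8) (Fin 4) F :=
  O * (O.submatrix firstFour id)⁻¹

/-- The Cremona transformation at the first four points, in coordinates in which these are the
standard basis vectors: they are kept, and all coordinates of the other four points are inverted. -/
noncomputable def cremonaOctad {F : Type*} [Field F] (O : Matrix (Fin 8) (Fin 4) F) :
    Matrix (Fin 8) (Fin 4) F :=
  Matrix.of fun i j => if i.val < 4 then O i j else (O i j)⁻¹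

/-- Entrywise inclusion of a matrix over a subfield of `ℂ` into the complex matrices. -/
noncomputable def toComplex {K : IntermediateField ℚ ℂ} {m n : Type*} (N : Matrix m n K) : Matrix m n ℂ :=
  N.map (algebraMap K ℂ)

/-!
Since the quartic is smooth, `det M` does not vanish to second order at any point `p` of the plane,
so the polar forms `u M vᵀ` of points of the octad cannot have too many common zeros `p`. This puts
the octad in general position: the polar forms of distinct points are nonzero, no three points are
collinear and no four are coplanar. Expanding a principal `4 × 4` minor of the bitangent matrix,
whose diagonal is zero, then shows that every `b_ij` is a bitangent, and that distinct `b_ij` are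
not proportional.

Hence an automorphism of `ℂ` over `K` permutes the points of the octad and fixes each line
`b_ij = 0`, so it fixes every point, and the points are `K`-rational.

Once the first four points are the standard basis vectors, the diagonal of `M₁₂₃₄` vanishes and
`u⁻¹ M'₁₂₃₄ u⁻ᵀ = (∏ uᵢ)⁻¹ u M₁₂₃₄ uᵀ` for the entrywise inverse `u⁻¹` (the cubic Cremona
transformation), so inversion carries the one octad to the other. The first two cases of (c) are
read off from this. For the third, the quadrics of the pencil on which `b'_ij` vanishes share the
twisted cubic onto which inversion carries the line through `P_i⁻¹` and `P_j⁻¹`; the residual line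
of their intersection is the chord through the other two points, whence `b_kl` vanishes on the same
pencil.
-/

section PolarForm

variable {F : Type*} [Field F] {ι m n : Type*} [Fintype n]

/-- The polar form of the quadrics `u ↦ u A_t uᵀ`: it sends `u`, `v` to the vector of the values
`u A_t vᵀ`. For `ι = Fin 3` these are the coefficients of the linear form `u M vᵀ`. -/
def polarForm (A : ι → Matrix n n F) : (n → F) →ₗ[F] (n → F) →ₗ[F] ι → F :=
  LinearMap.mk₂ F (fun u v t => u ⬝ᵥ (A t).mulVec v)
    (fun _ _ _ => funext fun _ => add_dotProduct _ _ _)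
    (fun _ _ _ => funext fun _ => smul_dotProduct _ _ _)
    (fun _ _ _ => funext fun _ => by simp [Matrix.mulVec_add])
    (fun _ _ _ => funext fun _ => by simp [Matrix.mulVec_smul])

/-- The matrices `S A_t Sᵀ`, which describe the quadrics on the span of the rows of `S`. -/
def baseChange (A : ι → Matrix n n F) (S : Matrix m n F) : ι → Matrix m m F :=
  fun t => S * A t * S.transpose

variable {A : ι → Matrix n n F}

@[simp]
theorem polarForm_apply (u v : n → F) (t : ι) : polarForm A u v t = u ⬝ᵥ (A t).mulVec v := rfl

theorem polarForm_comm (hA : ∀ t, (A t).IsSymm) (u v : n → F) :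
    polarForm A u v = polarForm A v u := by
  ext t
  rw [polarForm_apply, polarForm_apply, dotProduct_comm, ← Matrix.vecMul_transpose, (hA t).eq,
    Matrix.dotProduct_mulVec]

theorem polarForm_map {E : Type*} [Field E] (σ : F →+* E) (u v : n → F) :
    polarForm (fun t => (A t).map σ) (σ ∘ u) (σ ∘ v) = σ ∘ polarForm A u v := by
  ext t
  simp [Matrix.mulVec, dotProduct]

theorem baseChange_apply (S : Matrix m n F) (t : ι) (i j : m) :
    baseChange A S t i j = polarForm A (S i) (S j) t := by
  rw [baseChange, Matrix.mul_assoc, Matrix.mul_apply_eq_vecMul, Matrix.vecMul, dotProduct]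
  rfl

theorem baseChange_isSymm (hA : ∀ t, (A t).IsSymm) (S : Matrix m n F) (t : ι) :
    (baseChange A S t).IsSymm := by
  ext i j
  rw [Matrix.transpose_apply, baseChange_apply, baseChange_apply, polarForm_comm hA]

theorem polarForm_baseChange [Fintype m] (S : Matrix m n F) (u v : m → F) :
    polarForm (baseChange A S) u v = polarForm A (Matrix.vecMul u S) (Matrix.vecMul v S) := by
  ext t
  simp [baseChange, ← Matrix.mulVec_mulVec, Matrix.mulVec_transpose,
    Matrix.dotProduct_mulVec, Matrix.vecMul_vecMul, Matrix.mul_assoc]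

end PolarForm

section LinearMatrix

variable {F : Type*} [Field F]

theorem linearForm_zero : linearForm (0 : Fin 3 → F) = 0 := by
  simp [linearForm]

theorem linearForm_smul (c : F) (a : Fin 3 → F) : linearForm (c • a) = C c * linearForm a := by
  simp [linearForm, Finset.mul_sum, mul_assoc]

theorem linearForm_isHomogeneous (a : Fin 3 → F) : (linearForm a).IsHomogeneous 1 :=
  IsHomogeneous.sum _ _ _ fun t _ => isHomogeneous_C_mul_X (a t) t

theorem eval_linearForm (p a : Fin 3 → F) : eval p (linearForm a) = a ⬝ᵥ p := by
  simp [linearForm, dotProduct]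

variable {m n : Type*} (A : Fin 3 → Matrix n n F)

theorem linearMatrix_apply (i j : n) : linearMatrix A i j = linearForm fun t => A t i j := rfl

theorem linearMatrix_isSymm {A : Fin 3 → Matrix n n F} (hA : ∀ t, (A t).IsSymm) :
    (linearMatrix A).IsSymm :=
  Matrix.IsSymm.ext fun i j => by simp only [linearMatrix_apply, (hA _).apply]

variable [Fintype n]

theorem linearMatrix_baseChange (S : Matrix m n F) :
    linearMatrix (baseChange A S) = S.map (C : F →+* MvPolynomial (Fin 3) F) * linearMatrix A *
      (S.map (C : F →+* MvPolynomial (Fin 3) F)).transpose := by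
  ext1 i j
  simp only [linearMatrix, baseChange, linearForm, Matrix.of_apply, Matrix.mul_apply,
    Matrix.map_apply, Matrix.transpose_apply, map_sum, map_mul, Finset.sum_mul, Finset.mul_sum]
  rw [Finset.sum_comm]
  refine Finset.sum_congr rfl fun k _ => ?_
  rw [Finset.sum_comm]
  exact Finset.sum_congr rfl fun _ _ => Finset.sum_congr rfl fun _ _ => by ring

theorem linearMatrix_baseChange_apply (S : Matrix m n F) (i j : m) :
    linearMatrix (baseChange A S) i j = linearForm (polarForm A (S i) (S j)) := by
  simp only [linearMatrix_apply, baseChange_apply]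

theorem det_linearMatrix_baseChange [DecidableEq n] (S : Matrix n n F) :
    (linearMatrix (baseChange A S)).det = C (S.det ^ 2) * (linearMatrix A).det := by
  have h : (S.map (C : F →+* MvPolynomial (Fin 3) F)).det = C S.det := (RingHom.map_det C S).symm
  rw [linearMatrix_baseChange, Matrix.det_mul, Matrix.det_mul, Matrix.det_transpose, h, map_pow]
  ring

theorem bitangentMatrix_apply (A : Fin 3 → Matrix (Fin 4) (Fin 4) F) (O : Matrix (Fin 8) (Fin 4) F)
    (i j : Fin 8) : bitangentMatrix A O i j = linearForm (polarForm A (O i) (O j)) := by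
  rw [bitangentMatrix, ← linearMatrix_baseChange, linearMatrix_baseChange_apply]

theorem principalBlock_eq_baseChange (A : Fin 3 → Matrix (Fin 4) (Fin 4) F)
    (O : Matrix (Fin 8) (Fin 4) F) : principalBlock A O = baseChange A (O.submatrix firstFour id) :=
  rfl

end LinearMatrix

section Determinants

theorem det_mem_pow_of_block_mem {R n : Type*} [CommRing R] [Fintype n] [DecidableEq n]
    {I : Ideal R} {M : Matrix n n R} {s t : Finset n} (h : ∀ i ∈ s, ∀ j ∈ t, M i j ∈ I) :
    M.det ∈ I ^ (s.card + t.card - Fintype.card n) := by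
  rw [Matrix.det_apply]
  refine sum_mem fun σ _ => Submodule.smul_of_tower_mem _ _ ?_
  have hcard : s.card + t.card - Fintype.card n ≤ (t ∩ s.map σ⁻¹.toEmbedding).card := by
    have := Finset.card_inter_add_card_union t (s.map σ⁻¹.toEmbedding)
    have := Finset.card_le_univ (t ∪ s.map σ⁻¹.toEmbedding)
    rw [Finset.card_map] at *
    omega
  refine Ideal.pow_le_pow_right hcard ?_
  rw [← Finset.prod_mul_prod_compl (t ∩ s.map σ⁻¹.toEmbedding), ← Finset.prod_const]
  refine Ideal.mul_mem_right _ _ (Ideal.prod_mem_prod fun i hi => ?_)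
  simp only [Finset.mem_inter, Finset.mem_map_equiv] at hi
  exact h _ hi.2 _ hi.1

theorem det_mem_sq_of_row_mem {R n : Type*} [CommRing R] [Fintype n] [DecidableEq n] {I : Ideal R}
    {M : Matrix n n R} {k : n} (hkk : M k k = 0) (hrow : ∀ j, M k j ∈ I) (hcol : ∀ j, M j k ∈ I) :
    M.det ∈ I ^ 2 := by
  rw [Matrix.det_apply]
  refine sum_mem fun σ _ => Submodule.smul_of_tower_mem _ _ ?_
  by_cases hσ : σ k = k
  · rw [Finset.prod_eq_zero (Finset.mem_univ k) (by rw [hσ, hkk])]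
    exact zero_mem _
  have hk : σ⁻¹ k ≠ k := fun h => hσ (Equiv.Perm.inv_eq_iff_eq.mp h).symm
  rw [← Finset.mul_prod_erase _ _ (Finset.mem_univ k), ← Finset.mul_prod_erase _ _
    (Finset.mem_erase.mpr ⟨hk, Finset.mem_univ (σ⁻¹ k)⟩), ← mul_assoc, pow_two]
  refine Ideal.mul_mem_right _ _ (Ideal.mul_mem_mul (hcol _) ?_)
  simpa using hrow (σ⁻¹ k)

theorem det_of_isSymm_of_diag_eq_zero {R : Type*} [CommRing R] {M : Matrix (Fin 4) (Fin 4) R}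
    (hM : M.IsSymm) (hd : ∀ i, M i i = 0) :
    M.det = (M 0 2 * M 1 3 - M 0 3 * M 1 2) ^ 2 + M 0 1 * (M 2 3 *
      (M 0 1 * M 2 3 - 2 * (M 0 2 * M 1 3 + M 0 3 * M 1 2))) := by
  have hM' : M = !![0, M 0 1, M 0 2, M 0 3; M 0 1, 0, M 1 2, M 1 3;
      M 0 2, M 1 2, 0, M 2 3; M 0 3, M 1 3, M 2 3, 0] := by
    ext i j
    fin_cases i <;> fin_cases j <;> first | exact hd _ | rfl | exact hM.apply _ _
  rw [hM']
  simp [Matrix.det_succ_row_zero, Fin.sum_univ_succ, Fin.succAbove]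
  ring

theorem bifidMatrix_isSymm {R : Type*} [Zero R] (N : Matrix (Fin 4) (Fin 4) R) :
    (bifidMatrix N).IsSymm :=
  Matrix.IsSymm.ext fun i j => by fin_cases i <;> fin_cases j <;> rfl

theorem det_bifidMatrix {R : Type*} [CommRing R] {N : Matrix (Fin 4) (Fin 4) R}
    (hN : N.IsSymm) (hd : ∀ i, N i i = 0) : (bifidMatrix N).det = N.det := by
  rw [det_of_isSymm_of_diag_eq_zero hN hd, det_of_isSymm_of_diag_eq_zero (bifidMatrix_isSymm N)
    fun i => by fin_cases i <;> rfl]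
  simp [bifidMatrix]
  ring

theorem sumExtend_apply_inl {F V ι : Type*} [DivisionRing F] [AddCommGroup V] [Module F V]
    {v : ι → V} (hv : LinearIndependent F v) (i : ι) :
    Module.Basis.sumExtend hv (Sum.inl i) = v i := by
  simp only [Module.Basis.sumExtend, Module.Basis.reindex_apply, Equiv.trans_def,
    Module.Basis.extend_apply_self]
  rfl

theorem exists_det_ne_zero_of_linearIndependent {F ι n : Type*} [Field F] [Fintype n]
    [DecidableEq n] {v : ι → n → F} (hv : LinearIndependent F v) :
    ∃ (S : Matrix n n F) (e : ι ↪ n), S.det ≠ 0 ∧ ∀ i, S (e i) = v i := by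
  let b := Module.Basis.sumExtend hv
  let f := b.indexEquiv (Pi.basisFun F n)
  refine ⟨Matrix.of (b.reindex f), Function.Embedding.inl.trans f.toEmbedding, ?_, fun i => ?_⟩
  · exact ((Matrix.isUnit_iff_isUnit_det _).mp
      (Matrix.linearIndependent_rows_iff_isUnit.mp (b.reindex f).linearIndependent)).ne_zero
  · change b.reindex f (f (Sum.inl i)) = v i
    rw [Module.Basis.reindex_apply, Equiv.symm_apply_apply, sumExtend_apply_inl]

end Determinants

theorem exists_dotProduct_eq_zero_of_sum_smul_eq_zero {F n : Type*} [Field F] [Fintype n]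
    {v : n → n → F} {c : n → F} (hc : c ≠ 0) (h : ∑ i, c i • v i = 0) :
    ∃ p ≠ 0, ∀ i, v i ⬝ᵥ p = 0 := by
  classical
  have hdet : (Matrix.of v).det = 0 :=
    Matrix.exists_vecMul_eq_zero_iff.mp ⟨c, hc, by rw [Matrix.vecMul_eq_sum]; exact h⟩
  obtain ⟨p, hp0, hp⟩ := Matrix.exists_mulVec_eq_zero_iff.mpr hdet
  exact ⟨p, hp0, congrFun hp⟩

section SmoothNets

theorem IsSmoothForm.C_mul {f : MvPolynomial (Fin 3) ℂ} (hf : IsSmoothForm f) {c : ℂ}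
    (hc : c ≠ 0) : IsSmoothForm (C c * f) := by
  intro p h0 h1
  exact hf p (by simpa [hc] using h0) fun t => by simpa [hc] using h1 t

theorem IsSmoothForm.eq_zero_of_mem_sq {f : MvPolynomial (Fin 3) ℂ} (hf : IsSmoothForm f)
    {p : Fin 3 → ℂ} (h : f ∈ RingHom.ker (eval p) ^ 2) : p = 0 := by
  have hp : eval p f = 0 ∧ ∀ t, eval p (pderiv t f) = 0 := by
    rw [pow_two] at h
    refine Submodule.mul_induction_on h (fun a ha b hb => ?_) fun a b ha hb => ?_
    · rw [RingHom.mem_ker] at ha hb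
      simp [ha, hb]
    · simp [ha.1, hb.1, ha.2, hb.2]
  exact hf p hp.1 hp.2

variable {n : Type*} [Fintype n] [DecidableEq n]

/-- A net of quadrics, given by three symmetric matrices, whose discriminant curve is smooth. -/
structure IsSmoothNet (A : Fin 3 → Matrix n n ℂ) : Prop where
  isSymm : ∀ t, (A t).IsSymm
  isSmoothForm_det : IsSmoothForm (linearMatrix A).det

namespace IsSmoothNet

variable {A : Fin 3 → Matrix n n ℂ}

theorem baseChange (hA : IsSmoothNet A) {S : Matrix n n ℂ} (hS : S.det ≠ 0) :
    IsSmoothNet (baseChange A S) where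
  isSymm := baseChange_isSymm hA.isSymm S
  isSmoothForm_det := by
    rw [det_linearMatrix_baseChange]
    exact hA.isSmoothForm_det.C_mul (pow_ne_zero 2 hS)

theorem eq_zero_of_polarForm_dotProduct_eq_zero (hA : IsSmoothNet A) {u : n → ℂ} (hu : u ≠ 0)
    (hq : polarForm A u u = 0) {p : Fin 3 → ℂ} (hp : ∀ v, polarForm A u v ⬝ᵥ p = 0) : p = 0 := by
  obtain ⟨S, e, hS, hSu⟩ := exists_det_ne_zero_of_linearIndependent
    (LinearIndependent.of_subsingleton (v := fun _ : Unit => u) () hu)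
  refine (hA.baseChange hS).isSmoothForm_det.eq_zero_of_mem_sq
    (det_mem_sq_of_row_mem (k := e ()) ?_ (fun j => ?_) fun j => ?_)
  · rw [linearMatrix_baseChange_apply, hSu, hq, linearForm_zero]
  · rw [RingHom.mem_ker, linearMatrix_baseChange_apply, eval_linearForm, hSu, hp]
  · rw [RingHom.mem_ker, linearMatrix_baseChange_apply, eval_linearForm, hSu,
      polarForm_comm hA.isSymm, hp]

theorem eq_zero_of_isotropic (hA : IsSmoothNet A) {ι : Type*} [Fintype ι] {v : ι → n → ℂ}
    (hv : LinearIndependent ℂ v) (hcard : Fintype.card n + 2 ≤ 2 * Fintype.card ι)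
    {p : Fin 3 → ℂ} (hp : ∀ i j, polarForm A (v i) (v j) ⬝ᵥ p = 0) : p = 0 := by
  obtain ⟨S, e, hS, hSv⟩ := exists_det_ne_zero_of_linearIndependent hv
  have hblock : ∀ i ∈ Finset.univ.map e, ∀ j ∈ Finset.univ.map e,
      linearMatrix (_root_.baseChange A S) i j ∈ RingHom.ker (eval p) := by
    simp only [Finset.mem_map, Finset.mem_univ, true_and]
    rintro _ ⟨i, rfl⟩ _ ⟨j, rfl⟩
    rw [RingHom.mem_ker, linearMatrix_baseChange_apply, eval_linearForm, hSv, hSv, hp]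
  refine (hA.baseChange hS).isSmoothForm_det.eq_zero_of_mem_sq
    (Ideal.pow_le_pow_right ?_ (det_mem_pow_of_block_mem hblock))
  rw [Finset.card_map, Finset.card_univ]
  lia

theorem polarForm_surjective (hA : IsSmoothNet A) {u : n → ℂ} (hu : u ≠ 0)
    (hq : polarForm A u u = 0) : Function.Surjective (polarForm A u) := by
  rw [← LinearMap.range_eq_top]
  by_contra hne
  obtain ⟨φ, hφ, hker⟩ := Submodule.exists_le_ker_of_lt_top _ (lt_top_iff_ne_top.mpr hne)
  obtain ⟨p, rfl⟩ := (dotProductEquiv ℂ (Fin 3)).surjective φ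
  refine hφ ((LinearEquiv.map_eq_zero_iff _).mpr
    (hA.eq_zero_of_polarForm_dotProduct_eq_zero hu hq fun v => ?_))
  rw [dotProduct_comm]
  exact hker ⟨v, rfl⟩

theorem exists_smul_of_polarForm_eq_zero {A : Fin 3 → Matrix (Fin 4) (Fin 4) ℂ}
    (hA : IsSmoothNet A) {u v : Fin 4 → ℂ} (hu : u ≠ 0) (hq : polarForm A u u = 0)
    (hv : polarForm A u v = 0) : ∃ c : ℂ, c • u = v := by
  have hker : Module.finrank ℂ (LinearMap.ker (polarForm A u)) = 1 := by
    have h := (polarForm A u).finrank_range_add_finrank_ker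
    rw [LinearMap.range_eq_top.mpr (hA.polarForm_surjective hu hq), finrank_top] at h
    simp only [Module.finrank_fintype_fun_eq_card, Fintype.card_fin] at h
    lia
  obtain ⟨c, hc⟩ := (finrank_eq_one_iff_of_nonzero' (⟨u, hq⟩ : LinearMap.ker (polarForm A u))
    (Subtype.coe_ne_coe.mp hu)).mp hker ⟨v, hv⟩
  exact ⟨c, congrArg Subtype.val hc⟩

end IsSmoothNet

end SmoothNets

section Octads

namespace IsCayleyOctad

variable {A : Fin 3 → Matrix (Fin 4) (Fin 4) ℂ} {O : Matrix (Fin 8) (Fin 4) ℂ}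

theorem polarForm_self (hO : IsCayleyOctad A O) (i : Fin 8) : polarForm A (O i) (O i) = 0 :=
  funext ((hO.2.2 (O i) (hO.1 i)).mpr ⟨i, 1, (one_smul ℂ _).symm⟩)

theorem exists_smul (hO : IsCayleyOctad A O) {u : Fin 4 → ℂ} (hu : u ≠ 0)
    (hq : polarForm A u u = 0) : ∃ i, ∃ c : ℂ, u = c • O i :=
  (hO.2.2 u hu).mp (congrFun hq)

theorem polarForm_ne_zero (hA : IsSmoothNet A) (hO : IsCayleyOctad A O) {i j : Fin 8}
    (hij : i ≠ j) : polarForm A (O i) (O j) ≠ 0 := by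
  intro h
  obtain ⟨c, hc⟩ := hA.exists_smul_of_polarForm_eq_zero (hO.1 i) (hO.polarForm_self i) h
  exact hij (hO.2.1 j i c hc.symm).symm

theorem notMem_span_pair (hA : IsSmoothNet A) (hO : IsCayleyOctad A O) {i j k : Fin 8}
    (hij : i ≠ j) (hik : i ≠ k) (hjk : j ≠ k) : O k ∉ Submodule.span ℂ {O i, O j} := by
  intro h
  obtain ⟨a, b, hk⟩ := Submodule.mem_span_pair.mp h
  have hab : (2 * a * b) • polarForm A (O i) (O j) = 0 := by
    have hself := hO.polarForm_self k
    rw [← hk] at hself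
    simp only [map_add, map_smul, LinearMap.add_apply, LinearMap.smul_apply, hO.polarForm_self,
      polarForm_comm hA.isSymm (O j) (O i)] at hself
    rw [← hself]
    module
  simp only [smul_eq_zero, mul_eq_zero, OfNat.ofNat_ne_zero, false_or] at hab
  rcases hab.resolve_right (hO.polarForm_ne_zero hA hij) with rfl | rfl
  · exact hjk (hO.2.1 k j b (by rw [← hk, zero_smul, zero_add])).symm
  · exact hik (hO.2.1 k i a (by rw [← hk, zero_smul, add_zero])).symm

theorem linearIndependent_three (hA : IsSmoothNet A) (hO : IsCayleyOctad A O) {s : Fin 3 → Fin 8}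
    (hs : Function.Injective s) : LinearIndependent ℂ fun k => O (s k) := by
  rw [linearIndependent_finSucc, linearIndependent_fin2]
  refine ⟨⟨hO.1 _, fun a h => ?_⟩, ?_⟩
  · exact hs.ne (by decide : (2 : Fin 3) ≠ 1) (hO.2.1 _ _ a h.symm).symm
  · have hrange : Set.range (Fin.tail fun k => O (s k)) = {O (s 1), O (s 2)} := by
      ext x
      simp [Fin.tail, Fin.exists_fin_two, eq_comm]
    rw [hrange]
    exact hO.notMem_span_pair hA (hs.ne (by decide)) (hs.ne (by decide)) (hs.ne (by decide))

theorem exists_polarForm_dotProduct_eq_zero (hA : IsSmoothNet A) (hO : IsCayleyOctad A O)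
    {s : Fin 4 → Fin 8} {g : Fin 3 → ℂ} (hg : ∑ k, g k • O (s k.succ) = O (s 0))
    (hg12 : g 1 * g 2 ≠ 0) :
    ∃ p ≠ 0, ∀ i j : Fin 3, polarForm A (O (s i.succ)) (O (s j.succ)) ⬝ᵥ p = 0 := by
  obtain ⟨b, hb⟩ : ∃ b : Fin 3 → Fin 3 → Fin 3 → ℂ,
      ∀ i j, polarForm A (O (s i.succ)) (O (s j.succ)) = b i j := ⟨_, fun _ _ => rfl⟩
  have hsymm (i j) : b i j = b j i := by rw [← hb, ← hb, polarForm_comm hA.isSymm]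
  have hdiag (i) : b i i = 0 := by rw [← hb, hO.polarForm_self]
  have hrel : ∑ k, ![g 0 * g 1, g 0 * g 2, g 1 * g 2] k • ![b 0 1, b 0 2, b 1 2] k = 0 := by
    have hself := hO.polarForm_self (s 0)
    simp only [← hg, Fin.sum_univ_three, map_add, map_smul, LinearMap.add_apply,
      LinearMap.smul_apply, hb, hdiag, hsymm 1 0, hsymm 2 0, hsymm 2 1] at hself
    refine (smul_eq_zero.mp ?_).resolve_left (two_ne_zero (α := ℂ))
    rw [← hself, Fin.sum_univ_three]
    simp only [Matrix.cons_val]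
    module
  obtain ⟨p, hp0, hp⟩ := exists_dotProduct_eq_zero_of_sum_smul_eq_zero
    (fun h => hg12 (congrFun h 2)) hrel
  have h01 : b 0 1 ⬝ᵥ p = 0 := hp 0
  have h02 : b 0 2 ⬝ᵥ p = 0 := hp 1
  have h12 : b 1 2 ⬝ᵥ p = 0 := hp 2
  refine ⟨p, hp0, fun i j => ?_⟩
  rw [hb]
  fin_cases i <;> fin_cases j <;>
    simp [hdiag, h01, h02, h12, hsymm 1 0, hsymm 2 0, hsymm 2 1]

theorem notMem_span_triple (hA : IsSmoothNet A) (hO : IsCayleyOctad A O) {s : Fin 4 → Fin 8}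
    (hs : Function.Injective s) :
    O (s 0) ∉ Submodule.span ℂ (Set.range fun k : Fin 3 => O (s k.succ)) := by
  intro h
  obtain ⟨g, hg⟩ := (Submodule.mem_span_range_iff_exists_fun ℂ).mp h
  have hcoeff : g 1 * g 2 ≠ 0 := by
    rw [Fin.sum_univ_three] at hg
    refine mul_ne_zero (fun h1 => ?_) fun h2 => ?_
    · refine hO.notMem_span_pair hA (i := s 1) (j := s 3) (k := s 0) (hs.ne (by decide))
        (hs.ne (by decide)) (hs.ne (by decide)) (Submodule.mem_span_pair.mpr ⟨g 0, g 2, ?_⟩)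
      simpa [h1] using hg
    · refine hO.notMem_span_pair hA (i := s 1) (j := s 2) (k := s 0) (hs.ne (by decide))
        (hs.ne (by decide)) (hs.ne (by decide)) (Submodule.mem_span_pair.mpr ⟨g 0, g 1, ?_⟩)
      simpa [h2] using hg
  obtain ⟨p, hp0, hp⟩ := exists_polarForm_dotProduct_eq_zero hA hO hg hcoeff
  exact hp0 (hA.eq_zero_of_isotropic
    (hO.linearIndependent_three hA (hs.comp (Fin.succ_injective 3))) (by simp) hp)

theorem linearIndependent_four (hA : IsSmoothNet A) (hO : IsCayleyOctad A O) {s : Fin 4 → Fin 8}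
    (hs : Function.Injective s) : LinearIndependent ℂ fun k => O (s k) :=
  linearIndependent_finSucc.mpr
    ⟨hO.linearIndependent_three hA (hs.comp (Fin.succ_injective 3)), hO.notMem_span_triple hA hs⟩

theorem det_submatrix_ne_zero (hA : IsSmoothNet A) (hO : IsCayleyOctad A O) {s : Fin 4 → Fin 8}
    (hs : Function.Injective s) : (O.submatrix s id).det ≠ 0 :=
  ((Matrix.isUnit_iff_isUnit_det _).mp (Matrix.linearIndependent_rows_iff_isUnit.mp
    (hO.linearIndependent_four hA hs))).ne_zero

theorem eq_zero_of_dotProduct_eq_zero (hA : IsSmoothNet A) (hO : IsCayleyOctad A O)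
    {s : Fin 4 → Fin 8} (hs : Function.Injective s) {w : Fin 4 → ℂ}
    (hw : ∀ k, O (s k) ⬝ᵥ w = 0) : w = 0 :=
  Matrix.eq_zero_of_mulVec_eq_zero (hO.det_submatrix_ne_zero hA hs) (funext hw)

end IsCayleyOctad

end Octads

section Bitangents

theorem isBitangent_of_C_mul_eq {f g h : MvPolynomial (Fin 3) ℂ} {a : Fin 3 → ℂ} (ha : a ≠ 0)
    (hg : g.IsHomogeneous 2) (hh : h.IsHomogeneous 3) {κ : ℂ} (hκ : κ ≠ 0)
    (hf : C κ * f = g ^ 2 + linearForm a * h) : IsBitangent f a := by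
  obtain ⟨e, he⟩ := IsAlgClosed.exists_pow_nat_eq κ⁻¹ two_pos
  refine ⟨ha, C e * g, C (e ^ 2) * h, hg.C_mul e, hh.C_mul (e ^ 2), ?_⟩
  calc f = C (e ^ 2) * (C κ * f) := by
        rw [he, ← mul_assoc, ← C_mul, inv_mul_cancel₀ hκ, C_1, one_mul]
    _ = (C e * g) ^ 2 + linearForm a * (C (e ^ 2) * h) := by rw [hf, C_pow]; ring

theorem exists_ne_zero_apply_self_eq_zero {k V : Type*} [Field k] [IsAlgClosed k] [NeZero (2 : k)]
    [AddCommGroup V] [Module k V] (B : V →ₗ[k] V →ₗ[k] k) (hV : 1 < Module.finrank k V) :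
    ∃ v ≠ 0, B v v = 0 := by
  have := Module.nontrivial_of_finrank_pos (zero_lt_one.trans hV)
  obtain ⟨u, hu⟩ := exists_ne (0 : V)
  by_cases huu : B u u = 0
  · exact ⟨u, hu, huu⟩
  obtain ⟨w, huw⟩ := exists_linearIndependent_pair_of_one_lt_finrank hV hu
  obtain ⟨r, hr⟩ := IsAlgClosed.exists_eq_mul_self (discrim (B u u) (B u w + B w u) (B w w))
  obtain ⟨x, hx⟩ := exists_quadratic_eq_zero huu ⟨r, hr⟩
  refine ⟨x • u + w, fun h => ?_, ?_⟩
  · simpa using (LinearIndependent.pair_iff.mp huw x 1 (by rwa [one_smul])).2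
  · simp only [map_add, map_smul, LinearMap.add_apply, LinearMap.smul_apply, smul_eq_mul]
    linear_combination hx

theorem one_lt_finrank_ker_dotProductBilin {F : Type*} [Field F] (l : Fin 3 → F) :
    1 < Module.finrank F (LinearMap.ker (dotProductBilin F F l)) := by
  have h := (dotProductBilin F F l).finrank_range_add_finrank_ker
  have hle := (LinearMap.range (dotProductBilin F F l)).finrank_le
  rw [Module.finrank_self] at hle
  rw [Module.finrank_fintype_fun_eq_card, Fintype.card_fin] at h
  lia

theorem exists_common_zero_of_line_and_conic {k : Type*} [Field k] [IsAlgClosed k]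
    [NeZero (2 : k)] (l : Fin 3 → k) (B : (Fin 3 → k) →ₗ[k] (Fin 3 → k) →ₗ[k] k) :
    ∃ p ≠ 0, l ⬝ᵥ p = 0 ∧ B p p = 0 := by
  obtain ⟨p, hp0, hp⟩ := exists_ne_zero_apply_self_eq_zero (B.domRestrict₁₂ _ _)
    (one_lt_finrank_ker_dotProductBilin l)
  exact ⟨p, Subtype.coe_ne_coe.mpr hp0, p.2, hp⟩

section BitangentMatrix

variable {F : Type*} [Field F] (A : Fin 3 → Matrix (Fin 4) (Fin 4) F) (O : Matrix (Fin 8) (Fin 4) F)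

theorem det_submatrix_bitangentMatrix (s : Fin 4 → Fin 8) :
    ((bitangentMatrix A O).submatrix s s).det =
      C ((O.submatrix s id).det ^ 2) * (linearMatrix A).det := by
  rw [← det_linearMatrix_baseChange, linearMatrix_baseChange]
  rfl

variable {A} in
theorem bitangentMatrix_isSymm (hA : ∀ t, (A t).IsSymm) : (bitangentMatrix A O).IsSymm :=
  Matrix.IsSymm.ext fun i j => by
    rw [bitangentMatrix_apply, bitangentMatrix_apply, polarForm_comm hA]

theorem bitangentMatrix_isHomogeneous (i j : Fin 8) :
    (bitangentMatrix A O i j).IsHomogeneous 1 := by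
  rw [bitangentMatrix_apply]
  exact linearForm_isHomogeneous _

end BitangentMatrix

namespace IsCayleyOctad

variable {A : Fin 3 → Matrix (Fin 4) (Fin 4) ℂ} {O : Matrix (Fin 8) (Fin 4) ℂ}

theorem bitangentMatrix_self (hO : IsCayleyOctad A O) (i : Fin 8) :
    bitangentMatrix A O i i = 0 := by
  rw [bitangentMatrix_apply, hO.polarForm_self, linearForm_zero]

theorem C_mul_det_linearMatrix (hA : IsSmoothNet A) (hO : IsCayleyOctad A O) (i j k l : Fin 8) :
    C ((O.submatrix ![i, j, k, l] id).det ^ 2) * (linearMatrix A).det =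
      (bitangentMatrix A O i k * bitangentMatrix A O j l -
        bitangentMatrix A O i l * bitangentMatrix A O j k) ^ 2 +
      bitangentMatrix A O i j * (bitangentMatrix A O k l *
        (bitangentMatrix A O i j * bitangentMatrix A O k l -
          2 * (bitangentMatrix A O i k * bitangentMatrix A O j l +
            bitangentMatrix A O i l * bitangentMatrix A O j k))) := by
  rw [← det_submatrix_bitangentMatrix, det_of_isSymm_of_diag_eq_zero
    ((bitangentMatrix_isSymm O hA.isSymm).submatrix _) fun m => hO.bitangentMatrix_self _]
  rfl

theorem isBitangent (hA : IsSmoothNet A) (hO : IsCayleyOctad A O) {f : MvPolynomial (Fin 3) ℂ}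
    {γ : ℂ} (hγ : γ ≠ 0) (hdet : (linearMatrix A).det = C γ * f) {i j : Fin 8} (hij : i ≠ j) :
    IsBitangent f (polarForm A (O i) (O j)) := by
  obtain ⟨k, l, hinj⟩ : ∃ k l : Fin 8, Function.Injective ![i, j, k, l] := by
    revert i j; decide
  have hκ : (O.submatrix ![i, j, k, l] id).det ^ 2 * γ ≠ 0 :=
    mul_ne_zero (pow_ne_zero 2 (hO.det_submatrix_ne_zero hA hinj)) hγ
  have B := bitangentMatrix_isHomogeneous A O
  have heq := hO.C_mul_det_linearMatrix hA i j k l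
  rw [hdet, ← mul_assoc, ← C_mul, bitangentMatrix_apply A O i j] at heq
  refine isBitangent_of_C_mul_eq (hO.polarForm_ne_zero hA hij)
    (((B i k).mul (B j l)).sub ((B i l).mul (B j k)))
    ((B k l).mul (n := 2) (IsHomogeneous.sub ?_ ?_)) hκ heq
  · exact (linearForm_isHomogeneous _).mul (B k l)
  · exact (((B i k).mul (B j l)).add ((B i l).mul (B j k))).C_mul 2

theorem polarForm_ne_smul_of_adjacent (hA : IsSmoothNet A) (hO : IsCayleyOctad A O) {i j k : Fin 8}
    (hij : i ≠ j) (hik : i ≠ k) (hjk : j ≠ k) (c : ℂ) :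
    polarForm A (O i) (O j) ≠ c • polarForm A (O i) (O k) := by
  intro h
  obtain ⟨e, he⟩ := hA.exists_smul_of_polarForm_eq_zero (v := O j - c • O k) (hO.1 i)
    (hO.polarForm_self i) (by rw [map_sub, map_smul, h, sub_self])
  exact hO.notMem_span_pair hA hik hij hjk.symm
    (Submodule.mem_span_pair.mpr ⟨e, c, by rw [he, sub_add_cancel]⟩)

theorem polarForm_ne_smul_of_disjoint (hA : IsSmoothNet A) (hO : IsCayleyOctad A O)
    {i j k l : Fin 8} (hinj : Function.Injective ![i, j, k, l]) (c : ℂ) :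
    polarForm A (O i) (O j) ≠ c • polarForm A (O k) (O l) := by
  intro h
  let φ (i j : Fin 8) := dotProductBilin ℂ ℂ (polarForm A (O i) (O j))
  obtain ⟨p, hp0, hkl, hconic⟩ := exists_common_zero_of_line_and_conic (polarForm A (O k) (O l))
    ((LinearMap.mul ℂ ℂ).compl₁₂ (φ i k) (φ j l) - (LinearMap.mul ℂ ℂ).compl₁₂ (φ i l) (φ j k))
  have hmem_kl : bitangentMatrix A O k l ∈ RingHom.ker (eval p) := by
    rw [bitangentMatrix_apply, RingHom.mem_ker, eval_linearForm, hkl]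
  have hmem_conic : bitangentMatrix A O i k * bitangentMatrix A O j l -
      bitangentMatrix A O i l * bitangentMatrix A O j k ∈ RingHom.ker (eval p) := by
    simpa [RingHom.mem_ker, bitangentMatrix_apply, eval_linearForm, φ] using hconic
  have hij : bitangentMatrix A O i j = C c * bitangentMatrix A O k l := by
    rw [bitangentMatrix_apply, bitangentMatrix_apply, h, linearForm_smul]
  refine hp0 ((hA.isSmoothForm_det.C_mul (pow_ne_zero 2 (hO.det_submatrix_ne_zero hA
    hinj))).eq_zero_of_mem_sq ?_)
  rw [hO.C_mul_det_linearMatrix hA, hij, mul_assoc (C c), ← mul_assoc (bitangentMatrix A O k l),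
    ← pow_two]
  exact add_mem (Ideal.pow_mem_pow hmem_conic 2)
    (Ideal.mul_mem_left _ _ (Ideal.mul_mem_right _ _ (Ideal.pow_mem_pow hmem_kl 2)))

theorem eq_or_eq_of_polarForm_eq_smul (hA : IsSmoothNet A) (hO : IsCayleyOctad A O)
    {i j k l : Fin 8} (hij : i ≠ j) (hkl : k ≠ l) {c : ℂ}
    (h : polarForm A (O i) (O j) = c • polarForm A (O k) (O l)) : k = i ∨ k = j := by
  by_contra! hk
  by_cases hli : l = i
  · rw [hli, polarForm_comm hA.isSymm (O k)] at h
    exact hO.polarForm_ne_smul_of_adjacent hA hij hk.1.symm hk.2.symm c h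
  by_cases hlj : l = j
  · rw [hlj, polarForm_comm hA.isSymm (O k), polarForm_comm hA.isSymm (O i)] at h
    exact hO.polarForm_ne_smul_of_adjacent hA hij.symm hk.2.symm hk.1.symm c h
  refine hO.polarForm_ne_smul_of_disjoint hA ?_ c h
  clear h
  revert i j k l
  decide

end IsCayleyOctad

end Bitangents

section Embeddings

theorem exists_ringHom_comp_algebraMap {R S M : Type*} [CommRing R] [IsDomain R] [CommRing S]
    [IsDomain S] [Algebra R S] [Module.IsTorsionFree R S] [Algebra.IsAlgebraic R S] [Field M]
    [IsAlgClosed M] {ψ : R →+* M} (hψ : Function.Injective ψ) :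
    ∃ σ : S →+* M, σ.comp (algebraMap R S) = ψ := by
  let := ψ.toAlgebra
  have : FaithfulSMul R M := (faithfulSMul_iff_algebraMap_injective R M).mpr hψ
  exact ⟨(IsAlgClosed.lift : S →ₐ[R] M), AlgHom.comp_algebraMap _⟩

theorem exists_ringHom_comp_aeval {R M ι : Type*} [CommRing R] [Nontrivial R] [Field M]
    [IsAlgClosed M] [Algebra R M] {x : ι → M} (hx : IsTranscendenceBasis R x)
    {θ : MvPolynomial ι R →+* MvPolynomial ι R} (hθ : Function.Injective θ) :
    ∃ σ : M →+* M, ∀ p, σ (aeval x p) = aeval x (θ p) := by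
  have := hx.isAlgebraic
  let e := hx.1.aevalEquiv
  let ψ : Algebra.adjoin R (Set.range x) →+* M :=
    ((aeval x : MvPolynomial ι R →ₐ[R] M) : MvPolynomial ι R →+* M).comp
      (θ.comp (e.symm : _ →+* MvPolynomial ι R))
  have hψ : Function.Injective ψ :=
    (algebraicIndependent_iff_injective_aeval.mp hx.1).comp (hθ.comp e.symm.injective)
  obtain ⟨σ, hσ⟩ := exists_ringHom_comp_algebraMap (S := M) hψ
  refine ⟨σ, fun p => ?_⟩
  calc σ (aeval x p) = ψ (e p) := by
        rw [← hx.1.algebraMap_aevalEquiv]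
        exact RingHom.congr_fun hσ (e p)
    _ = aeval x (θ p) := congrArg (fun q => aeval x (θ q)) (e.symm_apply_apply p)

variable {K M : Type*} [Field K] [Field M] [IsAlgClosed M] [Algebra K M]

theorem exists_algHom_apply_eq_sq {α : M} (hα : Transcendental K α) :
    ∃ σ : M →ₐ[K] M, σ α = α ^ 2 := by
  have hindep : AlgebraicIndepOn K id ({α} : Set M) := by
    rwa [AlgebraicIndepOn, algebraicIndependent_unique_type_iff]
  obtain ⟨s, hs, hbasis⟩ := exists_isTranscendenceBasis_superset hindep
  obtain ⟨σ, hσ⟩ := exists_ringHom_comp_aeval hbasis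
    (θ := ((expand 2 : MvPolynomial s K →ₐ[K] MvPolynomial s K) : _ →+* MvPolynomial s K))
    (expand_injective two_pos)
  refine ⟨{ σ with commutes' := fun r => ?_ }, ?_⟩
  · simpa using hσ (C r)
  · simpa using hσ (X ⟨α, hs rfl⟩)

theorem exists_algHom_extending_algebraicClosure
    (τ : algebraicClosure K M →ₐ[K] algebraicClosure K M) :
    ∃ σ : M →ₐ[K] M, ∀ x : algebraicClosure K M, σ x = τ x := by
  obtain ⟨s, hs⟩ := exists_isTranscendenceBasis (algebraicClosure K M) M
  obtain ⟨σ, hσ⟩ := exists_ringHom_comp_aeval hs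
    (θ := map (τ : algebraicClosure K M →+* algebraicClosure K M)) (map_injective _ τ.injective)
  have hτ (x : algebraicClosure K M) : σ x = τ x := by simpa using hσ (C x)
  exact ⟨{ σ with commutes' := fun r => by simpa using hτ (algebraMap K _ r) }, hτ⟩

theorem mem_range_algebraMap_of_forall_algHom_apply_eq [PerfectField K] {α : M}
    (h : ∀ σ : M →ₐ[K] M, σ α = α) : α ∈ Set.range (algebraMap K M) := by
  have halg : IsAlgebraic K α := by
    by_contra hα
    obtain ⟨σ, hσ⟩ := exists_algHom_apply_eq_sq hα
    rw [h, eq_comm, pow_two] at hσ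
    rcases IsIdempotentElem.iff_eq_zero_or_one.mp hσ with rfl | rfl
    · exact hα isAlgebraic_zero
    · exact hα isAlgebraic_one
  have : IsGalois K (algebraicClosure K M) := ⟨⟩
  obtain ⟨r, hr⟩ := (InfiniteGalois.mem_range_algebraMap_iff_fixed
      (⟨α, mem_algebraicClosure_iff.mpr halg⟩ : algebraicClosure K M)).mpr fun τ => by
    obtain ⟨σ, hσ⟩ := exists_algHom_extending_algebraicClosure τ.toAlgHom
    exact Subtype.ext ((hσ _).symm.trans (h σ))
  exact ⟨r, congrArg Subtype.val hr⟩

end Embeddings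

section Rationality

namespace IsCayleyOctad

variable {A : Fin 3 → Matrix (Fin 4) (Fin 4) ℂ} {O : Matrix (Fin 8) (Fin 4) ℂ}

theorem of_samePoints {O' : Matrix (Fin 8) (Fin 4) ℂ} (hO : IsCayleyOctad A O)
    (h : SamePoints O' O) : IsCayleyOctad A O' := by
  choose c hc h using h
  have h' (i) : O i = (c i)⁻¹ • O' i := by rw [h, inv_smul_smul₀ (hc i)]
  refine ⟨fun i => ?_, fun i j e hij => ?_, fun u hu => ?_⟩
  · rw [h]
    exact smul_ne_zero (hc i) (hO.1 i)
  · exact hO.2.1 i j ((c i)⁻¹ * e * c j) (by rw [h' i, hij, h j, smul_smul, smul_smul])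
  · rw [hO.2.2 u hu]
    constructor
    · rintro ⟨i, e, rfl⟩
      exact ⟨i, e * (c i)⁻¹, by rw [h', smul_smul]⟩
    · rintro ⟨i, e, rfl⟩
      exact ⟨i, e * c i, by rw [h, smul_smul]⟩

theorem exists_comp_eq_smul (hO : IsCayleyOctad A O) {σ : ℂ →+* ℂ}
    (hσA : ∀ t, (A t).map σ = A t) (i : Fin 8) : ∃ k, ∃ c : ℂ, c ≠ 0 ∧ σ ∘ O i = c • O k := by
  have hne : σ ∘ O i ≠ 0 := fun h => hO.1 i (σ.injective.comp_left (h.trans (by ext; simp)))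
  have hself : polarForm A (σ ∘ O i) (σ ∘ O i) = 0 := by
    have hmap := polarForm_map (A := A) σ (O i) (O i)
    simp only [hσA] at hmap
    rw [hmap, hO.polarForm_self]
    ext
    simp
  obtain ⟨k, c, hk⟩ := hO.exists_smul hne hself
  exact ⟨k, c, fun h => hne (by rw [hk, h, zero_smul]), hk⟩

theorem samePoints_map (hA : IsSmoothNet A) (hO : IsCayleyOctad A O) {σ : ℂ →+* ℂ}
    (hσA : ∀ t, (A t).map σ = A t)
    (hσ : ∀ i j, i ≠ j → ∃ e : ℂ, σ ∘ polarForm A (O i) (O j) = e • polarForm A (O i) (O j)) :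
    SamePoints (O.map σ) O := by
  choose π c hc hπ using hO.exists_comp_eq_smul hσA
  have hmap (i j) : σ ∘ polarForm A (O i) (O j) =
      (c i * c j) • polarForm A (O (π i)) (O (π j)) := by
    have h := polarForm_map (A := A) σ (O i) (O j)
    simp only [hσA] at h
    rw [← h, hπ, hπ, map_smul, LinearMap.map_smul₂, smul_smul, mul_comm]
  have hinj : Function.Injective π := by
    intro i j hij
    by_contra hne
    refine hO.polarForm_ne_zero hA hne (σ.injective.comp_left ?_)
    dsimp only
    rw [hmap, hij, hO.polarForm_self, smul_zero]
    ext
    simp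
  have hfix_or (i j) (hij : i ≠ j) : i = π i ∨ i = π j := by
    obtain ⟨e, he⟩ := hσ i j hij
    refine hO.eq_or_eq_of_polarForm_eq_smul hA (hinj.ne hij) hij (c := (c i * c j)⁻¹ * e) ?_
    rw [mul_smul, ← he, hmap, inv_smul_smul₀ (mul_ne_zero (hc i) (hc j))]
  have hfix (i) : π i = i := by
    obtain ⟨j, k, hij, hik, hjk⟩ : ∃ j k, i ≠ j ∧ i ≠ k ∧ j ≠ k := by
      revert i
      decide
    by_contra hi
    exact hjk (hinj (((hfix_or i j hij).resolve_left (Ne.symm hi)).symm.trans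
      ((hfix_or i k hik).resolve_left (Ne.symm hi))))
  exact fun i => ⟨c i, hc i, (hπ i).trans (by rw [hfix])⟩

theorem exists_samePoints_map_algebraMap {K : Type*} [Field K] [Algebra K ℂ]
    {A : Fin 3 → Matrix (Fin 4) (Fin 4) K} (hA : IsSmoothNet fun t => (A t).map (algebraMap K ℂ))
    (hO : IsCayleyOctad (fun t => (A t).map (algebraMap K ℂ)) O)
    (hrat : ∀ i j, i ≠ j → ∃ (c : ℂ) (r : Fin 3 → K),
      polarForm (fun t => (A t).map (algebraMap K ℂ)) (O i) (O j) = c • (algebraMap K ℂ ∘ r)) :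
    ∃ Q : Matrix (Fin 8) (Fin 4) K, SamePoints (Q.map (algebraMap K ℂ)) O := by
  have : CharZero K := (algebraMap K ℂ).charZero_iff (algebraMap K ℂ).injective |>.mpr inferInstance
  have hsame (σ : ℂ →ₐ[K] ℂ) : SamePoints (O.map σ) O := by
    refine hO.samePoints_map hA (σ := σ) (fun t => by ext; simp) fun i j hij => ?_
    obtain ⟨c, r, h⟩ := hrat i j hij
    refine ⟨σ c / c, ?_⟩
    rw [h, smul_smul, div_mul_cancel_of_imp (by rintro rfl; exact map_zero σ)]
    ext
    simp
  choose k hk using fun i => Function.ne_iff.mp (hO.1 i)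
  have hfixed (i j) : O i j / O i (k i) ∈ Set.range (algebraMap K ℂ) := by
    refine mem_range_algebraMap_of_forall_algHom_apply_eq fun σ => ?_
    obtain ⟨e, he, h⟩ := hsame σ i
    rw [map_div₀]
    exact (congrArg₂ _ (congrFun h j) (congrFun h (k i))).trans (mul_div_mul_left _ _ he)
  choose Q hQ using hfixed
  refine ⟨Matrix.of Q, fun i => ⟨(O i (k i))⁻¹, inv_ne_zero (hk i), funext fun j => ?_⟩⟩
  exact (hQ i j).trans (div_eq_inv_mul _ _)

end IsCayleyOctad

end Rationality

section Normalization

theorem injective_update {α β : Type*} [DecidableEq α] {f : α → β} (hf : Function.Injective f)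
    {b : β} (hb : ∀ x, f x ≠ b) (a : α) : Function.Injective (Function.update f a b) := by
  intro x y hxy
  simp only [Function.update_apply] at hxy
  split_ifs at hxy with hx hy hy
  exacts [hx.trans hy.symm, (hb y hxy.symm).elim, (hb x hxy).elim, hf hxy]

variable {F : Type*} [Field F]

theorem firstFour_injective : Function.Injective firstFour := Fin.castLE_injective _

theorem exists_eq_firstFour_or_four_le (i : Fin 8) : (∃ k, i = firstFour k) ∨ 4 ≤ i.val :=
  (lt_or_ge i.val 4).imp_left fun hi => ⟨⟨i, hi⟩, rfl⟩

theorem firstFour_ne {i : Fin 8} (hi : 4 ≤ i.val) (k : Fin 4) : firstFour k ≠ i :=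
  fun h => (h ▸ k.isLt : i.val < 4).not_ge hi

theorem vecMul_normalizedOctad {Q : Matrix (Fin 8) (Fin 4) F}
    (hQ : IsUnit (Q.submatrix firstFour id).det) (i : Fin 8) :
    Matrix.vecMul (normalizedOctad Q i) (Q.submatrix firstFour id) = Q i := by
  rw [normalizedOctad, Matrix.mul_apply_eq_vecMul, Matrix.vecMul_vecMul,
    Matrix.nonsing_inv_mul _ hQ, Matrix.vecMul_one]

theorem polarForm_normalizedOctad (A : Fin 3 → Matrix (Fin 4) (Fin 4) F)
    {Q : Matrix (Fin 8) (Fin 4) F} (hQ : IsUnit (Q.submatrix firstFour id).det) (i j : Fin 8) :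
    polarForm (principalBlock A Q) (normalizedOctad Q i) (normalizedOctad Q j) =
      polarForm A (Q i) (Q j) := by
  rw [principalBlock_eq_baseChange, polarForm_baseChange, vecMul_normalizedOctad hQ,
    vecMul_normalizedOctad hQ]

theorem normalizedOctad_firstFour {Q : Matrix (Fin 8) (Fin 4) F}
    (hQ : IsUnit (Q.submatrix firstFour id).det) (k : Fin 4) :
    normalizedOctad Q (firstFour k) = Pi.single k 1 := by
  have h : (normalizedOctad Q).submatrix firstFour id = 1 := Matrix.mul_nonsing_inv _ hQ
  ext j
  have hkj := congrFun (congrFun h k) j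
  simpa [Matrix.one_apply, Pi.single_apply, eq_comm] using hkj

theorem IsCayleyOctad.of_vecMul {A : Fin 3 → Matrix (Fin 4) (Fin 4) ℂ}
    {O O' : Matrix (Fin 8) (Fin 4) ℂ} (hO : IsCayleyOctad A O) {S : Matrix (Fin 4) (Fin 4) ℂ}
    (hS : IsUnit S.det) (hO' : ∀ i, Matrix.vecMul (O' i) S = O i) :
    IsCayleyOctad (baseChange A S) O' := by
  have hinj : Function.Injective fun u => Matrix.vecMul u S :=
    Matrix.vecMul_injective_of_isUnit ((Matrix.isUnit_iff_isUnit_det S).mpr hS)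
  refine ⟨fun i h => hO.1 i ?_, fun i j c h => hO.2.1 i j c ?_, fun u hu => ?_⟩
  · rw [← hO', h, Matrix.zero_vecMul]
  · rw [← hO', h, Matrix.smul_vecMul, hO']
  · have huS : Matrix.vecMul u S ≠ 0 := fun h => hu (hinj (h.trans (Matrix.zero_vecMul S).symm))
    have hpolar (t) : u ⬝ᵥ (baseChange A S t).mulVec u =
        Matrix.vecMul u S ⬝ᵥ (A t).mulVec (Matrix.vecMul u S) :=
      congrFun (polarForm_baseChange S u u) t
    simp only [hpolar, hO.2.2 _ huS, ← hO', ← Matrix.smul_vecMul, hinj.eq_iff]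

end Normalization

section NormalizedOctads

/-- The Cayley octad of a smooth net of quadrics, in coordinates in which its first four points are
the standard basis vectors. -/
structure IsNormalizedOctad (G : Fin 3 → Matrix (Fin 4) (Fin 4) ℂ) (O : Matrix (Fin 8) (Fin 4) ℂ) :
    Prop where
  isSmoothNet : IsSmoothNet G
  isCayleyOctad : IsCayleyOctad G O
  apply_firstFour : ∀ k, O (firstFour k) = Pi.single k 1

theorem IsCayleyOctad.isNormalizedOctad {A : Fin 3 → Matrix (Fin 4) (Fin 4) ℂ}
    {Q : Matrix (Fin 8) (Fin 4) ℂ} (hA : IsSmoothNet A) (hQ : IsCayleyOctad A Q) :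
    IsNormalizedOctad (principalBlock A Q) (normalizedOctad Q) := by
  have hdet := hQ.det_submatrix_ne_zero hA firstFour_injective
  rw [principalBlock_eq_baseChange]
  exact ⟨hA.baseChange hdet, hQ.of_vecMul hdet.isUnit (vecMul_normalizedOctad hdet.isUnit),
    normalizedOctad_firstFour hdet.isUnit⟩

namespace IsNormalizedOctad

variable {G : Fin 3 → Matrix (Fin 4) (Fin 4) ℂ} {O : Matrix (Fin 8) (Fin 4) ℂ}

theorem apply_self (h : IsNormalizedOctad G O) (t : Fin 3) (k : Fin 4) : G t k k = 0 := by
  simpa [h.apply_firstFour] using congrFun (h.isCayleyOctad.polarForm_self (firstFour k)) t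

theorem entry_ne_zero (h : IsNormalizedOctad G O) {i : Fin 8} (hi : 4 ≤ i.val) (j : Fin 4) :
    O i j ≠ 0 := by
  intro hij
  have hw := h.isCayleyOctad.eq_zero_of_dotProduct_eq_zero h.isSmoothNet
    (injective_update firstFour_injective (firstFour_ne hi) j) (w := Pi.single j 1) fun k => by
      rcases eq_or_ne k j with rfl | hk
      · simpa using hij
      · simp [hk, h.apply_firstFour, hk.symm]
  simpa using congrFun hw j

theorem minor_ne_zero (h : IsNormalizedOctad G O) {i i' : Fin 8} (hi : 4 ≤ i.val)
    (hi' : 4 ≤ i'.val) (hii' : i ≠ i') {j j' : Fin 4} (hjj' : j ≠ j') :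
    O i j * O i' j' - O i j' * O i' j ≠ 0 := by
  intro hminor
  have hne (k) : Function.update firstFour j i k ≠ i' := by
    rcases eq_or_ne k j with rfl | hk
    · simpa using hii'
    · simpa [hk] using firstFour_ne hi' k
  have hw := h.isCayleyOctad.eq_zero_of_dotProduct_eq_zero h.isSmoothNet
    (injective_update (injective_update firstFour_injective (firstFour_ne hi) j) hne j')
    (w := Pi.single j (O i j') - Pi.single j' (O i j)) fun k => by
      rcases eq_or_ne k j' with rfl | hk'
      · simp only [Function.update_self, dotProduct_sub, dotProduct_single]
        linear_combination -hminor
      · rcases eq_or_ne k j with rfl | hk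
        · simp only [hk', Function.update_of_ne, Function.update_self, dotProduct_sub,
            dotProduct_single, ne_eq, not_false_eq_true]
          ring
        · simp [hk, hk', h.apply_firstFour, hk.symm, hk'.symm]
  exact h.entry_ne_zero hi j' (by simpa [hjj'] using congrFun hw j)

end IsNormalizedOctad

end NormalizedOctads

section BifidSubstitution

theorem bifidMatrix_apply_self {R : Type*} [Zero R] (N : Matrix (Fin 4) (Fin 4) R) (i : Fin 4) :
    bifidMatrix N i i = 0 := by
  fin_cases i <;> rfl

theorem bifidMatrix_apply_of_eq_univ {R : Type*} [Zero R] {N : Matrix (Fin 4) (Fin 4) R}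
    (hN : N.IsSymm) {i j k l : Fin 4} (h : ({i, j, k, l} : Finset (Fin 4)) = Finset.univ) :
    bifidMatrix N i j = N k l := by
  fin_cases i <;> fin_cases j <;> fin_cases k <;> fin_cases l <;>
    first | exact absurd h (by decide) | rfl | exact hN.apply _ _

theorem linearMatrix_bifidMatrix {F : Type*} [Field F] (G : Fin 3 → Matrix (Fin 4) (Fin 4) F) :
    linearMatrix (fun t => bifidMatrix (G t)) = bifidMatrix (linearMatrix G) := by
  ext1 i j
  fin_cases i <;> fin_cases j <;> simp [linearMatrix, bifidMatrix, linearForm]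

variable {F : Type*} [Field F] {N : Matrix (Fin 4) (Fin 4) F}

theorem dotProduct_mulVec_of_diag_eq_zero (hN : N.IsSymm) (hd : ∀ i, N i i = 0)
    (u v : Fin 4 → F) :
    u ⬝ᵥ N.mulVec v = N 0 1 * (u 0 * v 1 + u 1 * v 0) + N 0 2 * (u 0 * v 2 + u 2 * v 0) +
      N 0 3 * (u 0 * v 3 + u 3 * v 0) + N 1 2 * (u 1 * v 2 + u 2 * v 1) +
      N 1 3 * (u 1 * v 3 + u 3 * v 1) + N 2 3 * (u 2 * v 3 + u 3 * v 2) := by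
  simp only [dotProduct, Matrix.mulVec, Fin.sum_univ_four, hd, hN.apply 0 1, hN.apply 0 2,
    hN.apply 0 3, hN.apply 1 2, hN.apply 1 3, hN.apply 2 3]
  ring

theorem dotProduct_bifidMatrix_mulVec (N : Matrix (Fin 4) (Fin 4) F) (u v : Fin 4 → F) :
    u ⬝ᵥ (bifidMatrix N).mulVec v =
      N 2 3 * (u 0 * v 1 + u 1 * v 0) + N 1 3 * (u 0 * v 2 + u 2 * v 0) +
      N 1 2 * (u 0 * v 3 + u 3 * v 0) + N 0 3 * (u 1 * v 2 + u 2 * v 1) +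
      N 0 2 * (u 1 * v 3 + u 3 * v 1) + N 0 1 * (u 2 * v 3 + u 3 * v 2) :=
  dotProduct_mulVec_of_diag_eq_zero (bifidMatrix_isSymm N) (bifidMatrix_apply_self N) u v

theorem inv_dotProduct_bifidMatrix_mulVec_inv (hN : N.IsSymm) (hd : ∀ i, N i i = 0)
    {w : Fin 4 → F} (hw : ∀ j, w j ≠ 0) :
    w⁻¹ ⬝ᵥ (bifidMatrix N).mulVec w⁻¹ = (∏ j, w j)⁻¹ * (w ⬝ᵥ N.mulVec w) := by
  obtain ⟨h0, h1, h2, h3⟩ : w 0 ≠ 0 ∧ w 1 ≠ 0 ∧ w 2 ≠ 0 ∧ w 3 ≠ 0 := ⟨hw 0, hw 1, hw 2, hw 3⟩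
  rw [dotProduct_bifidMatrix_mulVec, dotProduct_mulVec_of_diag_eq_zero hN hd, Fin.prod_univ_four]
  simp only [Pi.inv_apply]
  field_simp
  ring

theorem single_dotProduct_bifidMatrix_mulVec_inv [NeZero (2 : F)] (hN : N.IsSymm)
    (hd : ∀ i, N i i = 0) {w : Fin 4 → F} (hw : ∀ j, w j ≠ 0) (hq : w ⬝ᵥ N.mulVec w = 0)
    (k : Fin 4) :
    Pi.single k 1 ⬝ᵥ (bifidMatrix N).mulVec w⁻¹ =
      -(w k ^ 2 * (∏ j, w j)⁻¹) * (Pi.single k 1 ⬝ᵥ N.mulVec w) := by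
  obtain ⟨h0, h1, h2, h3⟩ : w 0 ≠ 0 ∧ w 1 ≠ 0 ∧ w 2 ≠ 0 ∧ w 3 ≠ 0 := ⟨hw 0, hw 1, hw 2, hw 3⟩
  have hsum : N 0 1 * (w 0 * w 1) + N 0 2 * (w 0 * w 2) + N 0 3 * (w 0 * w 3) +
      N 1 2 * (w 1 * w 2) + N 1 3 * (w 1 * w 3) + N 2 3 * (w 2 * w 3) = 0 := by
    rw [dotProduct_mulVec_of_diag_eq_zero hN hd] at hq
    refine (mul_eq_zero.mp ?_).resolve_left (two_ne_zero (α := F))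
    linear_combination hq
  rw [dotProduct_bifidMatrix_mulVec, dotProduct_mulVec_of_diag_eq_zero hN hd, Fin.prod_univ_four]
  fin_cases k <;> simp <;> field_simp <;> linear_combination hsum

theorem dotProduct_bifidMatrix_mulVec_self_of_apply_eq_zero (hN : N.IsSymm) {k : Fin 4}
    (hd : N k k = 0) {u : Fin 4 → F} (hu : u k = 0) :
    u ⬝ᵥ (bifidMatrix N).mulVec u =
      2 * N.mulVec (fun j => ∏ m, if m = j ∨ m = k then 1 else u m) k := by
  rw [dotProduct_bifidMatrix_mulVec]
  fin_cases k <;>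
    simp_all [Matrix.mulVec, dotProduct, Fin.sum_univ_four, Fin.prod_univ_four, hN.apply 0 1,
      hN.apply 0 2, hN.apply 0 3, hN.apply 1 2, hN.apply 1 3, hN.apply 2 3] <;>
    ring

end BifidSubstitution

section Cremona

theorem smul_pi_inv {F n : Type*} [Field F] (c : F) (v : n → F) : (c • v)⁻¹ = c⁻¹ • v⁻¹ :=
  funext fun _ => mul_inv _ _

theorem cremonaOctad_firstFour {F : Type*} [Field F] (O : Matrix (Fin 8) (Fin 4) F) (k : Fin 4) :
    cremonaOctad O (firstFour k) = O (firstFour k) := by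
  ext j
  have hk : (firstFour k).val < 4 := k.isLt
  simp [cremonaOctad, hk]

namespace IsNormalizedOctad

variable {G : Fin 3 → Matrix (Fin 4) (Fin 4) ℂ} {O : Matrix (Fin 8) (Fin 4) ℂ}

-- Since `0⁻¹ = 0`, inverting all entries also fixes the standard basis vectors.
theorem cremonaOctad_apply (h : IsNormalizedOctad G O) (i : Fin 8) :
    cremonaOctad O i = (O i)⁻¹ := by
  ext j
  rcases exists_eq_firstFour_or_four_le i with ⟨k, rfl⟩ | hi
  · rw [cremonaOctad_firstFour, h.apply_firstFour, Pi.inv_apply, Pi.single_apply]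
    split_ifs <;> simp
  · simp [cremonaOctad, hi.not_gt]

theorem polarForm_bifid_cremonaOctad_self (h : IsNormalizedOctad G O) (i : Fin 8) :
    polarForm (fun t => bifidMatrix (G t)) (cremonaOctad O i) (cremonaOctad O i) = 0 := by
  ext t
  rw [polarForm_apply, h.cremonaOctad_apply]
  rcases exists_eq_firstFour_or_four_le i with ⟨k, rfl⟩ | hi
  · rw [← h.cremonaOctad_apply, cremonaOctad_firstFour, h.apply_firstFour]
    simp [bifidMatrix_apply_self]
  · rw [inv_dotProduct_bifidMatrix_mulVec_inv (h.isSmoothNet.isSymm t) (h.apply_self t)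
      (h.entry_ne_zero hi), ← polarForm_apply, h.isCayleyOctad.polarForm_self, Pi.zero_apply,
      mul_zero]

theorem apply_mul_apply_eq_zero (h : IsNormalizedOctad G O) {u : Fin 4 → ℂ}
    (hq : ∀ t, u ⬝ᵥ (bifidMatrix (G t)).mulVec u = 0) {k : Fin 4} (hk : u k = 0) {i j : Fin 4}
    (hij : i ≠ j) : u i * u j = 0 := by
  obtain ⟨v, hv⟩ : ∃ v : Fin 4 → ℂ, ∀ j, v j = ∏ m, if m = j ∨ m = k then 1 else u m :=
    ⟨_, fun _ => rfl⟩
  have hpolar : polarForm G (O (firstFour k)) v = 0 := by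
    ext t
    have hqt := hq t
    rw [dotProduct_bifidMatrix_mulVec_self_of_apply_eq_zero (h.isSmoothNet.isSymm t)
      (h.apply_self t k) hk, ← funext hv] at hqt
    simpa [h.apply_firstFour] using hqt
  obtain ⟨c, hc⟩ := h.isSmoothNet.exists_smul_of_polarForm_eq_zero
    (h.isCayleyOctad.1 (firstFour k)) (h.isCayleyOctad.polarForm_self _) hpolar
  by_contra hne
  obtain ⟨hi, hj⟩ := mul_ne_zero_iff.mp hne
  have hcover : ∀ i j k : Fin 4, i ≠ j → i ≠ k → j ≠ k →
      ∃ l ≠ k, ∀ m, m ≠ l → m ≠ k → m = i ∨ m = j := by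
    decide
  obtain ⟨l, hl, hm⟩ := hcover i j k hij (fun hik => hi (hik ▸ hk)) (fun hjk => hj (hjk ▸ hk))
  have hvl : v l = 0 := by
    rw [← hc, h.apply_firstFour]
    simp [hl]
  refine Finset.prod_ne_zero_iff.mpr (fun m _ => ?_) ((hv l).symm.trans hvl)
  split_ifs with hmlk
  · exact one_ne_zero
  · rw [not_or] at hmlk
    rcases hm m hmlk.1 hmlk.2 with rfl | rfl <;> assumption

theorem exists_eq_smul_single (h : IsNormalizedOctad G O) {u : Fin 4 → ℂ} (hu : u ≠ 0)
    (hq : ∀ t, u ⬝ᵥ (bifidMatrix (G t)).mulVec u = 0) {k : Fin 4} (hk : u k = 0) :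
    ∃ j, ∃ c : ℂ, u = c • Pi.single j 1 := by
  obtain ⟨j, hj⟩ := Function.ne_iff.mp hu
  refine ⟨j, u j, ?_⟩
  ext i
  rcases eq_or_ne i j with rfl | hij
  · simp
  · simpa [hij] using (mul_eq_zero.mp (h.apply_mul_apply_eq_zero hq hk hij)).resolve_right hj

theorem exists_eq_smul_cremonaOctad (h : IsNormalizedOctad G O) {u : Fin 4 → ℂ} (hu : u ≠ 0)
    (hq : ∀ t, u ⬝ᵥ (bifidMatrix (G t)).mulVec u = 0) : ∃ i, ∃ c : ℂ, u = c • cremonaOctad O i := by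
  by_cases hu0 : ∃ k, u k = 0
  · obtain ⟨k, hk⟩ := hu0
    obtain ⟨j, c, hc⟩ := h.exists_eq_smul_single hu hq hk
    exact ⟨firstFour j, c, by rw [cremonaOctad_firstFour, h.apply_firstFour, hc]⟩
  · push Not at hu0
    have hinv (j) : u⁻¹ j ≠ 0 := inv_ne_zero (hu0 j)
    have hquad : polarForm G u⁻¹ u⁻¹ = 0 := by
      ext t
      have hqt := hq t
      rw [← inv_inv u, inv_dotProduct_bifidMatrix_mulVec_inv (h.isSmoothNet.isSymm t)
        (h.apply_self t) hinv] at hqt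
      exact (mul_eq_zero.mp hqt).resolve_left
        (inv_ne_zero (Finset.prod_ne_zero_iff.mpr fun j _ => hinv j))
    obtain ⟨i, c, hc⟩ := h.isCayleyOctad.exists_smul (fun hu' => hinv 0 (congrFun hu' 0)) hquad
    exact ⟨i, c⁻¹, by rw [h.cremonaOctad_apply, ← smul_pi_inv, ← hc, inv_inv]⟩

theorem isSmoothNet_bifid (h : IsNormalizedOctad G O) :
    IsSmoothNet fun t => bifidMatrix (G t) where
  isSymm t := bifidMatrix_isSymm (G t)
  isSmoothForm_det := by
    rw [linearMatrix_bifidMatrix, det_bifidMatrix]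
    · exact h.isSmoothNet.isSmoothForm_det
    · exact linearMatrix_isSymm h.isSmoothNet.isSymm
    · intro i
      simp only [linearMatrix_apply, h.apply_self]
      exact linearForm_zero

theorem bifid (h : IsNormalizedOctad G O) :
    IsNormalizedOctad (fun t => bifidMatrix (G t)) (cremonaOctad O) where
  isSmoothNet := h.isSmoothNet_bifid
  isCayleyOctad := by
    refine ⟨fun i hi => ?_, fun i j c hc => ?_, fun u hu =>
      ⟨h.exists_eq_smul_cremonaOctad hu, ?_⟩⟩
    · rw [h.cremonaOctad_apply] at hi
      exact h.isCayleyOctad.1 i (funext fun j => inv_eq_zero.mp (congrFun hi j))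
    · rw [h.cremonaOctad_apply, h.cremonaOctad_apply, inv_eq_iff_eq_inv, smul_pi_inv,
        inv_inv] at hc
      exact h.isCayleyOctad.2.1 i j c⁻¹ hc
    · rintro ⟨i, c, rfl⟩ t
      rw [← polarForm_apply (A := fun t => bifidMatrix (G t)), map_smul, map_smul,
        LinearMap.smul_apply, h.polarForm_bifid_cremonaOctad_self, smul_zero, smul_zero]
      rfl
  apply_firstFour k := by rw [cremonaOctad_firstFour, h.apply_firstFour]

theorem polarForm_bifid_of_eq_firstFour (h : IsNormalizedOctad G O) {i j k l : Fin 8}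
    (hijkl : ({i, j, k, l} : Finset (Fin 8)) = {0, 1, 2, 3}) :
    polarForm (fun t => bifidMatrix (G t)) (cremonaOctad O i) (cremonaOctad O j) =
      polarForm G (O k) (O l) := by
  have hrange {m} (hm : m ∈ ({i, j, k, l} : Finset (Fin 8))) : ∃ m', m = firstFour m' := by
    rw [hijkl] at hm
    revert m
    decide
  obtain ⟨i, rfl⟩ := hrange (m := i) (by simp)
  obtain ⟨j, rfl⟩ := hrange (m := j) (by simp)
  obtain ⟨k, rfl⟩ := hrange (m := k) (by simp)
  obtain ⟨l, rfl⟩ := hrange (m := l) (by simp)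
  have huniv : ({i, j, k, l} : Finset (Fin 4)) = Finset.univ := by
    apply Finset.image_injective firstFour_injective
    simp only [Finset.image_insert, Finset.image_singleton, hijkl]
    decide
  ext t
  simp [cremonaOctad_firstFour, h.apply_firstFour,
    bifidMatrix_apply_of_eq_univ (h.isSmoothNet.isSymm t) huniv]

theorem exists_polarForm_bifid_mixed (h : IsNormalizedOctad G O) (k : Fin 4) {j : Fin 8}
    (hj : 4 ≤ j.val) : ∃ c : ℂ, c ≠ 0 ∧
      polarForm (fun t => bifidMatrix (G t)) (cremonaOctad O (firstFour k)) (cremonaOctad O j) =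
        c • polarForm G (O (firstFour k)) (O j) := by
  have hne := h.entry_ne_zero hj
  refine ⟨-(O j k ^ 2 * (∏ m, O j m)⁻¹), neg_ne_zero.mpr (mul_ne_zero (pow_ne_zero 2 (hne k))
    (inv_ne_zero (Finset.prod_ne_zero_iff.mpr fun m _ => hne m))), ?_⟩
  ext t
  rw [cremonaOctad_firstFour, h.cremonaOctad_apply, h.apply_firstFour]
  exact single_dotProduct_bifidMatrix_mulVec_inv (h.isSmoothNet.isSymm t) (h.apply_self t) hne
    (congrFun (h.isCayleyOctad.polarForm_self j) t) k

end IsNormalizedOctad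

end Cremona

section ThreeSpace

open scoped Matrix

variable {F : Type*} [Field F]

theorem exists_linearIndependent_of_dotProduct_eq_zero {l p : Fin 3 → F} (hp : p ≠ 0)
    (hlp : l ⬝ᵥ p = 0) : ∃ q, l ⬝ᵥ q = 0 ∧ LinearIndependent F ![p, q] := by
  obtain ⟨q, hpq⟩ := exists_linearIndependent_pair_of_one_lt_finrank
    (one_lt_finrank_ker_dotProductBilin l) (x := ⟨p, hlp⟩) (Subtype.coe_ne_coe.mp hp)
  refine ⟨q, q.2, ?_⟩
  rw [LinearIndependent.pair_iff] at hpq ⊢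
  exact fun s t hst => hpq s t (Subtype.ext hst)

theorem dotProduct_crossProduct_eq_zero {a b c n : Fin 3 → F} (hn : n ≠ 0) (ha : a ⬝ᵥ n = 0)
    (hb : b ⬝ᵥ n = 0) (hc : c ⬝ᵥ n = 0) : a ⬝ᵥ b ⨯₃ c = 0 := by
  rw [triple_product_eq_det]
  refine Matrix.exists_mulVec_eq_zero_iff.mp ⟨n, hn, ?_⟩
  ext i
  fin_cases i <;> assumption

theorem dotProduct_crossProduct_eq_zero_of_span {c c' x y x' y' : Fin 3 → F}
    (hc : LinearIndependent F ![c, c']) (hxy : LinearIndependent F ![x, y])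
    (hxy' : LinearIndependent F ![x', y']) (h1 : c ⬝ᵥ x ⨯₃ y = 0) (h2 : c' ⬝ᵥ x ⨯₃ y = 0)
    (h1' : c ⬝ᵥ x' ⨯₃ y' = 0) (h2' : c' ⬝ᵥ x' ⨯₃ y' = 0) : c ⬝ᵥ x ⨯₃ y' = 0 := by
  have hn := crossProduct_ne_zero_iff_linearIndependent.mpr hc
  have hm := crossProduct_ne_zero_iff_linearIndependent.mpr hxy
  have hm' := crossProduct_ne_zero_iff_linearIndependent.mpr hxy'
  exact dotProduct_crossProduct_eq_zero hn (dot_self_cross c c')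
    (dotProduct_crossProduct_eq_zero hm (dot_self_cross x y) h1 h2)
    (dotProduct_crossProduct_eq_zero hm' (dot_cross_self x' y') h1' h2')

theorem exists_eq_smul_of_dotProduct_eq_zero_imp {n : Type*} [Fintype n] {β δ : n → F}
    (h : ∀ p, β ⬝ᵥ p = 0 → δ ⬝ᵥ p = 0) : ∃ c : F, δ = c • β := by
  have hspan : dotProductBilin F F δ ∈ Submodule.span F (Set.range fun _ : Unit =>
      dotProductBilin F F β) :=
    mem_span_of_iInf_ker_le_ker (by simpa [SetLike.le_def] using h)
  rw [Set.range_const, Submodule.mem_span_singleton] at hspan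
  obtain ⟨c, hc⟩ := hspan
  refine ⟨c, dotProduct_eq _ _ fun p => ?_⟩
  rw [smul_dotProduct]
  exact (LinearMap.congr_fun hc p).symm

end ThreeSpace

section TwistedCubic

open scoped Matrix

variable {F : Type*} [Field F]

/-- The differences `y_j - y_0`, which determine `y` up to a constant vector. -/
def differences : (Fin 4 → F) →ₗ[F] Fin 3 → F where
  toFun y j := y j.succ - y 0
  map_add' _ _ := funext fun _ => add_sub_add_comm _ _ _ _
  map_smul' _ _ := funext fun _ => (mul_sub _ _ _).symm

theorem differences_apply (y : Fin 4 → F) (j : Fin 3) : differences y j = y j.succ - y 0 := rfl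

theorem differences_eq_zero_iff {y : Fin 4 → F} : differences y = 0 ↔ ∀ j, y j = y 0 := by
  simp [differences, funext_iff, Fin.forall_fin_succ (n := 3), sub_eq_zero]

theorem linearIndependent_differences {a b w : Fin 4 → F} (hw : ∀ j, w j ≠ 0)
    (hli : LinearIndependent F ![a, b, w⁻¹]) :
    LinearIndependent F ![differences (a * w), differences (b * w)] := by
  rw [LinearIndependent.pair_iff]
  intro s t hst
  rw [← map_smul, ← map_smul, ← map_add, differences_eq_zero_iff] at hst
  have hrel := Fintype.linearIndependent_iff.mp hli ![s, t, -((s • (a * w) + t • (b * w)) 0)] (by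
    ext j
    have hj := hst j
    simp only [Fin.sum_univ_three, Matrix.cons_val, Pi.add_apply, Pi.smul_apply, Pi.mul_apply,
      smul_eq_mul, Pi.inv_apply, Pi.zero_apply] at hj ⊢
    rw [← hj]
    field_simp [hw j]
    ring)
  exact ⟨by simpa using hrel 0, by simpa using hrel 1⟩

/-- The coordinates of an alternating form on `Fin 4 → F` that vanishes against constant vectors,
as a vector in the dual of the exterior square of `Fin 3 → F`; see `dotProduct_mulVec_eq_cross`. -/
def alternatingAxis : Matrix (Fin 4) (Fin 4) F →ₗ[F] Fin 3 → F where
  toFun ν := ![ν 2 3, ν 3 1, ν 1 2]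
  map_add' _ _ := by simp
  map_smul' _ _ := by simp

theorem alternatingAxis_apply (ν : Matrix (Fin 4) (Fin 4) F) :
    alternatingAxis ν = ![ν 2 3, ν 3 1, ν 1 2] := rfl

theorem dotProduct_mulVec_eq_cross {ν : Matrix (Fin 4) (Fin 4) F} (hν : ν.transpose = -ν)
    (hd : ∀ i, ν i i = 0) (h1 : ν *ᵥ 1 = 0) (x y : Fin 4 → F) :
    x ⬝ᵥ ν *ᵥ y = alternatingAxis ν ⬝ᵥ differences x ⨯₃ differences y := by
  have hskew (i j) : ν j i = -ν i j := congrFun (congrFun hν i) j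
  have hrow (i) : ν i 0 + ν i 1 + ν i 2 + ν i 3 = 0 := by
    simpa [Matrix.mulVec, dotProduct, Fin.sum_univ_four] using congrFun h1 i
  have hrow1 := hrow 1
  have hrow2 := hrow 2
  have hrow3 := hrow 3
  simp only [alternatingAxis_apply, cross_apply, differences_apply, dotProduct, Matrix.mulVec,
    Fin.sum_univ_four, Fin.sum_univ_three, Matrix.cons_val, Fin.succ_zero_eq_one,
    Fin.succ_one_eq_two, Fin.reduceSucc, hd, hskew 0 1, hskew 0 2, hskew 0 3, hskew 1 2, hskew 1 3,
    hskew 2 3] at hrow1 hrow2 hrow3 ⊢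
  linear_combination (x 1 * y 0 - x 0 * y 1) * hrow1 + (x 2 * y 0 - x 0 * y 2) * hrow2 +
    (x 3 * y 0 - x 0 * y 3) * hrow3

variable {n : Type*}

/-- For a quadric `N` through the coordinate points, the alternating form `ν` with
`u N vᵀ = (a u) ν (b v)ᵀ + (a v) ν (b u)ᵀ`, the products of vectors being entrywise. If `N` contains
the twisted cubic of the points `(1 / (s a_j + t b_j))_j`, this writes `N` as a combination of the
minors that cut out the cubic. -/
def cubicForm (a b : n → F) : Matrix n n F →ₗ[F] Matrix n n F where
  toFun N := Matrix.of fun i j => N i j / (a i * b j - a j * b i)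
  map_add' _ _ := Matrix.ext fun _ _ => add_div _ _ _
  map_smul' _ _ := Matrix.ext fun _ _ => mul_div_assoc _ _ _

theorem cubicForm_apply (a b : n → F) (N : Matrix n n F) (i j : n) :
    cubicForm a b N i j = N i j / (a i * b j - a j * b i) := rfl

theorem cubicForm_transpose (a b : n → F) {N : Matrix n n F} (hN : N.IsSymm) :
    (cubicForm a b N).transpose = -cubicForm a b N := by
  ext i j
  rw [Matrix.transpose_apply, Matrix.neg_apply, cubicForm_apply, cubicForm_apply, hN.apply,
    ← neg_sub (a i * b j), div_neg]

theorem dotProduct_mulVec_eq_cubicForm [Fintype n] {a b : n → F}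
    (hab : ∀ i j, i ≠ j → a i * b j - a j * b i ≠ 0) {N : Matrix n n F} (hN : N.IsSymm)
    (hd : ∀ i, N i i = 0) (u v : n → F) :
    u ⬝ᵥ N *ᵥ v =
      (a * u) ⬝ᵥ cubicForm a b N *ᵥ (b * v) + (a * v) ⬝ᵥ cubicForm a b N *ᵥ (b * u) := by
  have hswap : (a * v) ⬝ᵥ cubicForm a b N *ᵥ (b * u) =
      -((b * u) ⬝ᵥ cubicForm a b N *ᵥ (a * v)) := by
    rw [dotProduct_comm, ← Matrix.vecMul_transpose, cubicForm_transpose a b hN,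
      ← Matrix.dotProduct_mulVec, Matrix.neg_mulVec, dotProduct_neg]
  rw [hswap]
  simp only [dotProduct, Matrix.mulVec, Finset.mul_sum, ← Finset.sum_neg_distrib,
    ← Finset.sum_add_distrib, Pi.mul_apply]
  refine Finset.sum_congr rfl fun i _ => Finset.sum_congr rfl fun j _ => ?_
  have hij : N i j = (a i * b j - a j * b i) * cubicForm a b N i j := by
    rcases eq_or_ne i j with rfl | hij
    · rw [hd, sub_self, zero_mul]
    · rw [cubicForm_apply, mul_div_cancel₀ _ (hab i j hij)]
  rw [hij]
  ring

theorem sum_div_eq_zero_of_bifid [NeZero (2 : F)] {N : Matrix (Fin 4) (Fin 4) F} (hN : N.IsSymm)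
    {k : Fin 4} (hd : N k k = 0) {z : Fin 4 → F} (hk : z k = 0) (hz : ∀ j, j ≠ k → z j ≠ 0)
    (hq : z ⬝ᵥ bifidMatrix N *ᵥ z = 0) : ∑ j, N k j / z j = 0 := by
  rw [dotProduct_bifidMatrix_mulVec_self_of_apply_eq_zero hN hd hk] at hq
  have hsum := (mul_eq_zero.mp hq).resolve_left two_ne_zero
  have hprod : ∏ m, (if m = k then 1 else z m) ≠ 0 :=
    Finset.prod_ne_zero_iff.mpr fun m _ => by split_ifs with hm; exacts [one_ne_zero, hz m hm]
  refine (mul_eq_zero.mp ?_).resolve_left hprod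
  rw [← hsum, Matrix.mulVec, dotProduct, Finset.mul_sum]
  refine Finset.sum_congr rfl fun j _ => ?_
  rcases eq_or_ne j k with rfl | hj
  · simp [hd]
  · have hsplit : ∏ m, (if m = k then 1 else z m) =
        z j * ∏ m, if m = j ∨ m = k then 1 else z m := by
      rw [← Finset.mul_prod_erase _ _ (Finset.mem_univ j), if_neg hj,
        ← Finset.mul_prod_erase _ (fun m => if m = j ∨ m = k then 1 else z m) (Finset.mem_univ j),
        if_pos (Or.inl rfl), one_mul]
      exact congrArg _ (Finset.prod_congr rfl fun m hm => by simp [Finset.ne_of_mem_erase hm])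
    rw [hsplit]
    field_simp [hz j hj]

theorem cubicForm_mulVec_one [NeZero (2 : F)] {a b : Fin 4 → F}
    (hab : ∀ i j, i ≠ j → a i * b j - a j * b i ≠ 0) {N : Matrix (Fin 4) (Fin 4) F}
    (hN : N.IsSymm) (hd : ∀ i, N i i = 0)
    (hline : ∀ x y : F, (x • a + y • b) ⬝ᵥ bifidMatrix N *ᵥ (x • a + y • b) = 0) :
    cubicForm a b N *ᵥ 1 = 0 := by
  ext k
  have hsum := sum_div_eq_zero_of_bifid hN (hd k) (z := -b k • a + a k • b)
    (by simp [mul_comm]) (fun j hj => by simpa [mul_comm, neg_add_eq_sub] using hab k j hj.symm)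
    (hline _ _)
  simpa [Matrix.mulVec, dotProduct, cubicForm_apply, mul_comm, neg_add_eq_sub] using hsum

theorem dotProduct_mulVec_eq_cross_add_cross [NeZero (2 : F)] {a b : Fin 4 → F}
    (hab : ∀ i j, i ≠ j → a i * b j - a j * b i ≠ 0) {N : Matrix (Fin 4) (Fin 4) F}
    (hN : N.IsSymm) (hd : ∀ i, N i i = 0)
    (hline : ∀ x y : F, (x • a + y • b) ⬝ᵥ bifidMatrix N *ᵥ (x • a + y • b) = 0)
    (u v : Fin 4 → F) :
    u ⬝ᵥ N *ᵥ v =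
      alternatingAxis (cubicForm a b N) ⬝ᵥ differences (a * u) ⨯₃ differences (b * v) +
      alternatingAxis (cubicForm a b N) ⬝ᵥ differences (a * v) ⨯₃ differences (b * u) := by
  have hskew := cubicForm_transpose a b hN
  have hdiag (k) : cubicForm a b N k k = 0 := by rw [cubicForm_apply, hd, zero_div]
  have hone := cubicForm_mulVec_one hab hN hd hline
  rw [dotProduct_mulVec_eq_cubicForm hab hN hd, dotProduct_mulVec_eq_cross hskew hdiag hone,
    dotProduct_mulVec_eq_cross hskew hdiag hone]

end TwistedCubic

section Complementary

open scoped Matrix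

variable {F ι n : Type*} [Field F] [Fintype ι]

theorem polarForm_dotProduct [Fintype n] (A : ι → Matrix n n F) (u v : n → F) (p : ι → F) :
    polarForm A u v ⬝ᵥ p = u ⬝ᵥ Fintype.linearCombination F A p *ᵥ v := by
  rw [Fintype.linearCombination_apply, Matrix.sum_mulVec, dotProduct_sum, dotProduct]
  refine Finset.sum_congr rfl fun t _ => ?_
  rw [Matrix.smul_mulVec, dotProduct_smul, polarForm_apply, smul_eq_mul, mul_comm]

theorem bifidMatrix_linearCombination (G : ι → Matrix (Fin 4) (Fin 4) F) (p : ι → F) :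
    bifidMatrix (Fintype.linearCombination F G p) =
      Fintype.linearCombination F (fun t => bifidMatrix (G t)) p := by
  ext i j
  fin_cases i <;> fin_cases j <;>
    simp [Fintype.linearCombination_apply, Matrix.sum_apply, bifidMatrix]

/-- For the member with parameter `p` of the net `G`, its coordinates with respect to the minors
that cut out the twisted cubic of `a` and `b`. -/
def cubicCoordinates (G : Fin 3 → Matrix (Fin 4) (Fin 4) F) (a b : Fin 4 → F) :
    (Fin 3 → F) →ₗ[F] Fin 3 → F :=
  alternatingAxis ∘ₗ cubicForm a b ∘ₗ Fintype.linearCombination F G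

namespace IsNormalizedOctad

variable {G : Fin 3 → Matrix (Fin 4) (Fin 4) ℂ} {O : Matrix (Fin 8) (Fin 4) ℂ} {i j : Fin 8}
  {p : Fin 3 → ℂ}

theorem polarForm_dotProduct_eq_cross (h : IsNormalizedOctad G O) (hi : 4 ≤ i.val)
    (hj : 4 ≤ j.val) (hij : i ≠ j)
    (hp : polarForm (fun t => bifidMatrix (G t)) (cremonaOctad O i) (cremonaOctad O j) ⬝ᵥ p = 0)
    (u v : Fin 4 → ℂ) :
    polarForm G u v ⬝ᵥ p = cubicCoordinates G (cremonaOctad O i) (cremonaOctad O j) p ⬝ᵥ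
        differences (cremonaOctad O i * u) ⨯₃ differences (cremonaOctad O j * v) +
      cubicCoordinates G (cremonaOctad O i) (cremonaOctad O j) p ⬝ᵥ
        differences (cremonaOctad O i * v) ⨯₃ differences (cremonaOctad O j * u) := by
  rw [polarForm_dotProduct]
  refine dotProduct_mulVec_eq_cross_add_cross (fun _ _ => h.bifid.minor_ne_zero hi hj hij)
    ?_ ?_ (fun x y => ?_) u v
  · simp [Matrix.IsSymm, Fintype.linearCombination_apply, Matrix.transpose_sum,
      (h.isSmoothNet.isSymm _).eq]
  · simp [Fintype.linearCombination_apply, Matrix.sum_apply, h.apply_self]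
  · rw [bifidMatrix_linearCombination, ← polarForm_dotProduct]
    simp [h.polarForm_bifid_cremonaOctad_self, add_dotProduct, hp,
      polarForm_comm (fun t => bifidMatrix_isSymm (G t)) (cremonaOctad O j)]

theorem eq_zero_of_cubicCoordinates_eq_zero (h : IsNormalizedOctad G O) (hi : 4 ≤ i.val)
    (hj : 4 ≤ j.val) (hij : i ≠ j)
    (hp : polarForm (fun t => bifidMatrix (G t)) (cremonaOctad O i) (cremonaOctad O j) ⬝ᵥ p = 0)
    (hp0 : cubicCoordinates G (cremonaOctad O i) (cremonaOctad O j) p = 0) : p = 0 :=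
  h.isSmoothNet.eq_zero_of_polarForm_dotProduct_eq_zero (h.isCayleyOctad.1 i)
    (h.isCayleyOctad.polarForm_self i) fun v => by
      rw [h.polarForm_dotProduct_eq_cross hi hj hij hp, hp0, zero_dotProduct, zero_dotProduct,
        add_zero]

theorem linearIndependent_cubicCoordinates (h : IsNormalizedOctad G O) (hi : 4 ≤ i.val)
    (hj : 4 ≤ j.val) (hij : i ≠ j) {q : Fin 3 → ℂ}
    (hp : polarForm (fun t => bifidMatrix (G t)) (cremonaOctad O i) (cremonaOctad O j) ⬝ᵥ p = 0)
    (hq : polarForm (fun t => bifidMatrix (G t)) (cremonaOctad O i) (cremonaOctad O j) ⬝ᵥ q = 0)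
    (hpq : LinearIndependent ℂ ![p, q]) :
    LinearIndependent ℂ ![cubicCoordinates G (cremonaOctad O i) (cremonaOctad O j) p,
      cubicCoordinates G (cremonaOctad O i) (cremonaOctad O j) q] := by
  rw [LinearIndependent.pair_iff] at hpq ⊢
  intro s t hst
  rw [← map_smul, ← map_smul, ← map_add] at hst
  refine hpq s t (h.eq_zero_of_cubicCoordinates_eq_zero hi hj hij ?_ hst)
  rw [dotProduct_add, dotProduct_smul, dotProduct_smul, hp, hq, smul_zero, smul_zero, add_zero]

theorem cubicCoordinates_dotProduct_cross_eq_zero (h : IsNormalizedOctad G O) (hi : 4 ≤ i.val)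
    (hj : 4 ≤ j.val) (hij : i ≠ j)
    (hp : polarForm (fun t => bifidMatrix (G t)) (cremonaOctad O i) (cremonaOctad O j) ⬝ᵥ p = 0)
    (m : Fin 8) :
    cubicCoordinates G (cremonaOctad O i) (cremonaOctad O j) p ⬝ᵥ
      differences (cremonaOctad O i * O m) ⨯₃ differences (cremonaOctad O j * O m) = 0 := by
  have hself := h.polarForm_dotProduct_eq_cross hi hj hij hp (O m) (O m)
  rw [h.isCayleyOctad.polarForm_self, zero_dotProduct] at hself
  exact self_eq_neg.mp (eq_neg_of_add_eq_zero_left hself.symm)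

theorem linearIndependent_differences_cremonaOctad (h : IsNormalizedOctad G O) {m : Fin 8}
    (hm : 4 ≤ m.val) (hijm : Function.Injective ![i, j, m]) :
    LinearIndependent ℂ ![differences (cremonaOctad O i * O m),
      differences (cremonaOctad O j * O m)] := by
  refine linearIndependent_differences (h.entry_ne_zero hm) ?_
  have hvec : ![cremonaOctad O i, cremonaOctad O j, cremonaOctad O m] =
      fun k => cremonaOctad O (![i, j, m] k) := by
    ext k : 1
    fin_cases k <;> rfl
  rw [← h.cremonaOctad_apply, hvec]
  exact h.bifid.isCayleyOctad.linearIndependent_three h.bifid.isSmoothNet hijm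

/- The quadrics with parameters in the kernel of `b'_{ij}` form a pencil through a twisted cubic.
Both planes `⟨δ(aO_k), δ(bO_k)⟩` and `⟨δ(aO_l), δ(bO_l)⟩` contain the image of the pencil under
`cubicCoordinates`, so they agree. -/
theorem polarForm_dotProduct_eq_zero_of_complementary (h : IsNormalizedOctad G O) {k l : Fin 8}
    (hi : 4 ≤ i.val) (hj : 4 ≤ j.val) (hk : 4 ≤ k.val) (hl : 4 ≤ l.val)
    (hijk : Function.Injective ![i, j, k]) (hijl : Function.Injective ![i, j, l])
    (hp : polarForm (fun t => bifidMatrix (G t)) (cremonaOctad O i) (cremonaOctad O j) ⬝ᵥ p = 0) :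
    polarForm G (O k) (O l) ⬝ᵥ p = 0 := by
  have hij : i ≠ j := hijk.ne (a₁ := 0) (a₂ := 1) (by decide)
  rcases eq_or_ne p 0 with rfl | hp0
  · exact dotProduct_zero _
  obtain ⟨q, hq, hpq⟩ := exists_linearIndependent_of_dotProduct_eq_zero hp0 hp
  have hli := h.linearIndependent_cubicCoordinates hi hj hij hp hq hpq
  have hcoplanar {k l} (hijk : Function.Injective ![i, j, k]) (hk : 4 ≤ k.val)
      (hijl : Function.Injective ![i, j, l]) (hl : 4 ≤ l.val) :=
    dotProduct_crossProduct_eq_zero_of_span hli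
      (h.linearIndependent_differences_cremonaOctad hk hijk)
      (h.linearIndependent_differences_cremonaOctad hl hijl)
      (h.cubicCoordinates_dotProduct_cross_eq_zero hi hj hij hp k)
      (h.cubicCoordinates_dotProduct_cross_eq_zero hi hj hij hq k)
      (h.cubicCoordinates_dotProduct_cross_eq_zero hi hj hij hp l)
      (h.cubicCoordinates_dotProduct_cross_eq_zero hi hj hij hq l)
  rw [h.polarForm_dotProduct_eq_cross hi hj hij hp, hcoplanar hijk hk hijl hl,
    hcoplanar hijl hl hijk hk, add_zero]

end IsNormalizedOctad

end Complementary

section BitangentTable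

namespace IsNormalizedOctad

variable {G : Fin 3 → Matrix (Fin 4) (Fin 4) ℂ} {O : Matrix (Fin 8) (Fin 4) ℂ} {i j k l : Fin 8}

theorem exists_polarForm_bifid_of_eq_lastFour (h : IsNormalizedOctad G O)
    (hijkl : ({i, j, k, l} : Finset (Fin 8)) = {4, 5, 6, 7}) : ∃ c : ℂ, c ≠ 0 ∧
      polarForm (fun t => bifidMatrix (G t)) (cremonaOctad O i) (cremonaOctad O j) =
        c • polarForm G (O k) (O l) := by
  have hlast {m} (hm : m ∈ ({i, j, k, l} : Finset (Fin 8))) : 4 ≤ m.val := by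
    rw [hijkl] at hm
    revert m
    decide
  obtain ⟨hijk, hijl, hkl⟩ : Function.Injective ![i, j, k] ∧ Function.Injective ![i, j, l] ∧
      k ≠ l := by
    clear h hlast
    revert i j k l
    decide
  obtain ⟨c, hc⟩ := exists_eq_smul_of_dotProduct_eq_zero_imp fun p =>
    h.polarForm_dotProduct_eq_zero_of_complementary (hlast (m := i) (by simp))
      (hlast (m := j) (by simp)) (hlast (m := k) (by simp)) (hlast (m := l) (by simp))
      hijk hijl
  have hc0 : c ≠ 0 := by
    rintro rfl
    exact h.isCayleyOctad.polarForm_ne_zero h.isSmoothNet hkl (by rw [hc, zero_smul])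
  exact ⟨c⁻¹, inv_ne_zero hc0, by rw [hc, inv_smul_smul₀ hc0]⟩

theorem exists_polarForm_bifid_of_eq (h : IsNormalizedOctad G O)
    (hijkl : ({i, j, k, l} : Finset (Fin 8)) = {0, 1, 2, 3} ∨
      ({i, j, k, l} : Finset (Fin 8)) = {4, 5, 6, 7}) : ∃ c : ℂ, c ≠ 0 ∧
      polarForm (fun t => bifidMatrix (G t)) (cremonaOctad O i) (cremonaOctad O j) =
        c • polarForm G (O k) (O l) := by
  rcases hijkl with hfirst | hlast
  · exact ⟨1, one_ne_zero, by rw [h.polarForm_bifid_of_eq_firstFour hfirst, one_smul]⟩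
  · exact h.exists_polarForm_bifid_of_eq_lastFour hlast

theorem exists_polarForm_bifid_of_card_inter_eq_one (h : IsNormalizedOctad G O)
    (hij : (({i, j} : Finset (Fin 8)) ∩ {0, 1, 2, 3}).card = 1) (hne : i ≠ j) : ∃ c : ℂ, c ≠ 0 ∧
      polarForm (fun t => bifidMatrix (G t)) (cremonaOctad O i) (cremonaOctad O j) =
        c • polarForm G (O i) (O j) := by
  rcases exists_eq_firstFour_or_four_le i with ⟨i, rfl⟩ | hi <;>
    rcases exists_eq_firstFour_or_four_le j with ⟨j, rfl⟩ | hj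
  · exfalso
    clear h
    revert i j
    decide
  · exact h.exists_polarForm_bifid_mixed i hj
  · rw [polarForm_comm h.isSmoothNet_bifid.isSymm, polarForm_comm h.isSmoothNet.isSymm]
    exact h.exists_polarForm_bifid_mixed j hi
  · exfalso
    clear h
    revert i j
    decide

end IsNormalizedOctad

end BitangentTable

section BaseFieldExtension

variable {F E : Type*} [Field F] [Field E] (σ : F →+* E)

theorem det_linearMatrix_map (A : Fin 3 → Matrix (Fin 4) (Fin 4) F) :
    (linearMatrix fun t => (A t).map σ).det = map σ (linearMatrix A).det := by
  rw [RingHom.map_det]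
  congr 1
  ext1 i j
  simp [linearMatrix, linearForm]

theorem bifidMatrix_map (N : Matrix (Fin 4) (Fin 4) F) :
    bifidMatrix (N.map σ) = (bifidMatrix N).map σ := by
  ext i j
  fin_cases i <;> fin_cases j <;> simp [bifidMatrix]

theorem cremonaOctad_map (O : Matrix (Fin 8) (Fin 4) F) :
    cremonaOctad (O.map σ) = (cremonaOctad O).map σ := by
  ext i j
  simp only [cremonaOctad, Matrix.map_apply, Matrix.of_apply]
  split_ifs <;> simp

theorem principalBlock_map (A : Fin 3 → Matrix (Fin 4) (Fin 4) F) (O : Matrix (Fin 8) (Fin 4) F) :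
    principalBlock (fun t => (A t).map σ) (O.map σ) = fun t => (principalBlock A O t).map σ := by
  ext1 t
  simp only [principalBlock, ← Matrix.submatrix_map, Matrix.map_mul, Matrix.transpose_map]

theorem map_nonsing_inv {n : Type*} [Fintype n] [DecidableEq n] (S : Matrix n n F) :
    S⁻¹.map σ = (S.map σ)⁻¹ := by
  rw [Matrix.inv_def, Matrix.inv_def, Ring.inverse_eq_inv', Ring.inverse_eq_inv',
    ← RingHom.mapMatrix_apply σ S, ← RingHom.map_det, ← RingHom.map_adjugate, ← map_inv₀]
  ext i j
  simp

theorem normalizedOctad_map (O : Matrix (Fin 8) (Fin 4) F) :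
    normalizedOctad (O.map σ) = (normalizedOctad O).map σ := by
  rw [normalizedOctad, normalizedOctad, Matrix.map_mul, map_nonsing_inv, Matrix.submatrix_map]

variable {σ}

theorem SamePoints.map {O O' : Matrix (Fin 8) (Fin 4) F} (h : SamePoints O O') :
    SamePoints (O.map σ) (O'.map σ) := fun i => by
  obtain ⟨c, hc, hi⟩ := h i
  refine ⟨σ c, (map_ne_zero σ).mpr hc, funext fun j => ?_⟩
  simp [hi]

theorem exists_eq_smul_of_comp_eq_smul {n : Type*} {v w : n → F} {c : E} (hc : c ≠ 0)
    (h : σ ∘ v = c • (σ ∘ w)) : ∃ d : F, d ≠ 0 ∧ v = d • w := by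
  have happly (t) : σ (v t) = c * σ (w t) := congrFun h t
  rcases eq_or_ne w 0 with rfl | hw
  · exact ⟨1, one_ne_zero, funext fun t => σ.injective (by simp [happly])⟩
  obtain ⟨t, ht⟩ : ∃ t, w t ≠ 0 := Function.ne_iff.mp hw
  have hcd : σ (v t / w t) = c := by
    rw [map_div₀, happly, mul_div_cancel_right₀ _ ((map_ne_zero σ).mpr ht)]
  refine ⟨v t / w t, (map_ne_zero σ).mp (hcd ▸ hc), funext fun s => σ.injective ?_⟩
  rw [happly, Pi.smul_apply, smul_eq_mul, map_mul, hcd]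

theorem exists_bitangentMatrix_eq_smul {A B : Fin 3 → Matrix (Fin 4) (Fin 4) F}
    {O O' O'' : Matrix (Fin 8) (Fin 4) F} (hO' : SamePoints O' O'') {i j k l : Fin 8}
    (h : ∃ c : E, c ≠ 0 ∧ polarForm (fun t => (B t).map σ) (O''.map σ i) (O''.map σ j) =
      c • polarForm (fun t => (A t).map σ) (O.map σ k) (O.map σ l)) :
    ∃ c : F, c ≠ 0 ∧ bitangentMatrix B O' i j = c • bitangentMatrix A O k l := by
  obtain ⟨c, hc, hpolar⟩ := h
  obtain ⟨d, hd, hBA⟩ := exists_eq_smul_of_comp_eq_smul hc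
    ((polarForm_map σ _ _).symm.trans (hpolar.trans (congrArg (c • ·) (polarForm_map σ _ _))))
  obtain ⟨x, hx, hi⟩ := hO' i
  obtain ⟨y, hy, hj⟩ := hO' j
  refine ⟨x * y * d, mul_ne_zero (mul_ne_zero hx hy) hd, ?_⟩
  rw [bitangentMatrix_apply, bitangentMatrix_apply, hi, hj, map_smul, LinearMap.map_smul₂, hBA,
    smul_smul, smul_smul, linearForm_smul, C_mul', mul_comm y]

theorem exists_bitangentMatrix_bifid_eq_smul {G : Fin 3 → Matrix (Fin 4) (Fin 4) F}
    {O O' : Matrix (Fin 8) (Fin 4) F} (hO' : SamePoints O' (cremonaOctad O)) {i j k l : Fin 8}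
    (h : ∃ c : E, c ≠ 0 ∧ polarForm (fun t => bifidMatrix ((G t).map σ))
        (cremonaOctad (O.map σ) i) (cremonaOctad (O.map σ) j) =
      c • polarForm (fun t => (G t).map σ) (O.map σ k) (O.map σ l)) :
    ∃ c : F, c ≠ 0 ∧
      bitangentMatrix (fun t => bifidMatrix (G t)) O' i j = c • bitangentMatrix G O k l := by
  simp only [bifidMatrix_map, cremonaOctad_map] at h
  exact exists_bitangentMatrix_eq_smul hO' h

end BaseFieldExtension

section Descent

theorem IsBitangent.exists_eq_smul_algebraMap_comp {f : MvPolynomial (Fin 3) ℂ} {b : Fin 3 → ℂ}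
    (hb : IsBitangent f b) {K : IntermediateField ℚ ℂ} (hK : bitangentField f ≤ K) :
    ∃ (c : ℂ) (r : Fin 3 → K), b = c • (algebraMap K ℂ ∘ r) := by
  obtain ⟨t, ht⟩ : ∃ t, b t ≠ 0 := Function.ne_iff.mp hb.1
  have hratio (s) : b s / b t ∈ K :=
    hK (IntermediateField.subset_adjoin _ _ ⟨b, hb, s, t, ht, rfl⟩)
  exact ⟨b t, fun s => ⟨b s / b t, hratio s⟩, funext fun s => (mul_div_cancel₀ _ ht).symm⟩

variable {K : Type*} [Field K] [Algebra K ℂ] {A : Fin 3 → Matrix (Fin 4) (Fin 4) K}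
  {Q : Matrix (Fin 8) (Fin 4) K}

theorem bitangentMatrix_normalizedOctad {F : Type*} [Field F] (A : Fin 3 → Matrix (Fin 4) (Fin 4) F)
    {Q : Matrix (Fin 8) (Fin 4) F} (hQ : IsUnit (Q.submatrix firstFour id).det) :
    bitangentMatrix (principalBlock A Q) (normalizedOctad Q) = bitangentMatrix A Q := by
  ext1 i j
  rw [bitangentMatrix_apply, bitangentMatrix_apply, polarForm_normalizedOctad A hQ]

theorem IsCayleyOctad.isUnit_det_firstFour (hA : IsSmoothNet fun t => (A t).map (algebraMap K ℂ))
    (hQ : IsCayleyOctad (fun t => (A t).map (algebraMap K ℂ)) (Q.map (algebraMap K ℂ))) :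
    IsUnit (Q.submatrix firstFour id).det := by
  have hdet := hQ.det_submatrix_ne_zero hA firstFour_injective
  rw [Matrix.submatrix_map, ← RingHom.mapMatrix_apply, ← RingHom.map_det] at hdet
  exact ((map_ne_zero _).mp hdet).isUnit

theorem IsCayleyOctad.isNormalizedOctad_map
    (hA : IsSmoothNet fun t => (A t).map (algebraMap K ℂ))
    (hQ : IsCayleyOctad (fun t => (A t).map (algebraMap K ℂ)) (Q.map (algebraMap K ℂ))) :
    IsNormalizedOctad (fun t => (principalBlock A Q t).map (algebraMap K ℂ))
      ((normalizedOctad Q).map (algebraMap K ℂ)) := by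
  rw [← principalBlock_map, ← normalizedOctad_map]
  exact hQ.isNormalizedOctad hA

theorem IsNormalizedOctad.bifid_map {G : Fin 3 → Matrix (Fin 4) (Fin 4) K}
    {O : Matrix (Fin 8) (Fin 4) K}
    (h : IsNormalizedOctad (fun t => (G t).map (algebraMap K ℂ)) (O.map (algebraMap K ℂ))) :
    IsNormalizedOctad (fun t => (bifidMatrix (G t)).map (algebraMap K ℂ))
      ((cremonaOctad O).map (algebraMap K ℂ)) := by
  simpa only [bifidMatrix_map, cremonaOctad_map] using h.bifid

end Descent

theorem mainTheorem6
    (f : MvPolynomial (Fin 3) ℂ) (hf : f.IsHomogeneous 4) (hsmooth : IsSmoothForm f)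
    (K : IntermediateField ℚ ℂ) (hK : bitangentField f ≤ K)
    (A : Fin 3 → Matrix (Fin 4) (Fin 4) K) (hA : ∀ t, (A t).IsSymm)
    (γ : ℂ) (hγ : γ ≠ 0)
    (hdet : MvPolynomial.map (algebraMap K ℂ) (linearMatrix A).det = MvPolynomial.C γ * f)
    (P : Matrix (Fin 8) (Fin 4) ℂ) (hP : IsCayleyOctad (fun t => toComplex (A t)) P) :
    -- the points of the octad are `K`-rational
    (∃ Q : Matrix (Fin 8) (Fin 4) K, SamePoints (toComplex Q) P) ∧
    -- for all coordinate vectors over `K` of the points of the octad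
    ∀ Q : Matrix (Fin 8) (Fin 4) K, SamePoints (toComplex Q) P →
      -- the octad `O` of `M₁₂₃₄` and its Cremona transform are well defined
      IsUnit (Q.submatrix firstFour id).det ∧
      IsCayleyOctad (fun t => toComplex (principalBlock A Q t)) (toComplex (normalizedOctad Q)) ∧
      bitangentMatrix (principalBlock A Q) (normalizedOctad Q) = bitangentMatrix A Q ∧
      (∀ i : Fin 8, 4 ≤ i.val → ∀ j, normalizedOctad Q i j ≠ 0) ∧
      -- for all coordinate vectors over `K` of the points of the Cremona transform
      ∀ O' : Matrix (Fin 8) (Fin 4) K, SamePoints O' (cremonaOctad (normalizedOctad Q)) →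
        IsCayleyOctad (fun t => toComplex (bifidBlock A Q t)) (toComplex O') ∧
        (∀ i j k l : Fin 8,
          (({i, j, k, l} : Finset (Fin 8)) = {0, 1, 2, 3} ∨
            ({i, j, k, l} : Finset (Fin 8)) = {4, 5, 6, 7}) →
          ∃ c : K, c ≠ 0 ∧ bitangentMatrix (bifidBlock A Q) O' i j =
            c • bitangentMatrix (principalBlock A Q) (normalizedOctad Q) k l) ∧
        (∀ i j : Fin 8, i ≠ j → (({i, j} : Finset (Fin 8)) ∩ {0, 1, 2, 3}).card = 1 →
          ∃ c : K, c ≠ 0 ∧ bitangentMatrix (bifidBlock A Q) O' i j =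
            c • bitangentMatrix (principalBlock A Q) (normalizedOctad Q) i j) := by
  rw [← det_linearMatrix_map] at hdet
  have hnet : IsSmoothNet fun t => (A t).map (algebraMap K ℂ) :=
    ⟨fun t => (hA t).map _, hdet ▸ hsmooth.C_mul hγ⟩
  refine ⟨hP.exists_samePoints_map_algebraMap hnet fun i j hij =>
    (hP.isBitangent hnet hγ hdet hij).exists_eq_smul_algebraMap_comp hK, fun Q hQP => ?_⟩
  have hQ := hP.of_samePoints hQP
  have hunit := hQ.isUnit_det_firstFour hnet
  have hO := hQ.isNormalizedOctad_map hnet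
  refine ⟨hunit, hO.isCayleyOctad, bitangentMatrix_normalizedOctad A hunit,
    fun i hi j => ?_, fun O' hO' => ⟨?_, fun i j k l hijkl => ?_, fun i j hij hcard => ?_⟩⟩
  · exact (map_ne_zero (algebraMap K ℂ)).mp (hO.entry_ne_zero hi j)
  · exact hO.bifid_map.isCayleyOctad.of_samePoints hO'.map
  · exact exists_bitangentMatrix_bifid_eq_smul hO' (hO.exists_polarForm_bifid_of_eq hijkl)
  · exact exists_bitangentMatrix_bifid_eq_smul hO'
      (hO.exists_polarForm_bifid_of_card_inter_eq_one hcard hij)
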